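/- Let $1<p\le q<\infty$. There is a finite constant $C=C(p,q)$, depending only on $p$ and $q$, such that the following holds. Let $(\Omega,m)$ be an arbitrary measure space, and let $(T_t)_{t\ge 0}$ be a strongly continuous semigroup of linear operators on $L^1(\Omega)$ (real or complex scalars), that is, $T_0=I$, $T_{s+t}=T_sT_t$ and $t\mapsto T_tf\in L^1(\Omega)$ is continuous on $[0,\infty)$ for every $f\in L^1(\Omega)$. Assume that it satisfies the contraction property: $\|T_tf\|_{L^1}\le\|f\|_{L^1}$ for all $f\in L^1(\Omega)$, and $\|T_tf\|_{L^\infty}\le\|f\|_{L^\infty}$ for all $f\in L^1(\Omega)\cap L^\infty(\Omega)$, for every $t\ge0$. Each $T_t$ is extended by continuity from the dense subspace $L^1(\Omega)\cap L^\infty(\Omega)$ to $L^p(\Omega)$. For $f\in L^p(\Omega)$ put $A_0f=f$ and $A_\alpha f=\frac1\alpha\int_0^\alpha T_tf\,dt$ for $\alpha>0$ (a Bochner integral in $L^p(\Omega)$), and let $$M_Tf(x)=\sup_{\alpha\ge0}|A_\alpha f(x)|\qquad\text{for } m\text{-a.e. } x,$$ where for $A_\alpha f(x)$ one takes representatives such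 that, for $m$-a.e. $x$, $\alpha\mapsto A_\alpha f(x)$ is continuous on $(0,\infty)$. Let $f=(f_n)_{n\in\mathbb N}\in L^p(\ell^q)$, that is, the $f_n$ are measurable scalar functions with $$\|f\|_{L^p(\ell^q)}=\Big(\int_\Omega\Big(\sum_{n=0}^\infty|f_n(x)|^q\Big)^{p/q}dm(x)\Big)^{1/p}<\infty .$$ Then, for every $n$, $t\mapsto T_tf_n$ is Bochner integrable in $L^p(\Omega)$ over every $[0,\alpha]$, such representatives exist, $M_Tf_n$ is $m$-measurable, and $$\big\|(M_Tf_n)_{n\in\mathbb N}\big\|_{L^p(\ell^q)}\le C\,\|f\|_{L^p(\ell^q)} .$$ -/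

import Mathlib

open MeasureTheory Set Filter Topology
open scoped NNReal ENNReal

noncomputable section

namespace HopfDunfordSchwartz

/-- A semigroup `(T_t)_{t ≥ 0}` of linear operators which satisfies the contraction property (every
`T_t` is a contraction for the `L¹` norm and for the `L^∞` norm) and is strongly continuous.
The operators act on `L¹`; `contraction_top` is empty for the functions with `‖f‖_∞ = ∞`. -/
structure ContractionSemigroup (𝕜 : Type*) [RCLike 𝕜] {Ω : Type*} [MeasurableSpace Ω]
    (m : Measure Ω) where
  T : ℝ≥0 → Lp 𝕜 1 m →ₗ[𝕜] Lp 𝕜 1 m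
  map_zero : T 0 = LinearMap.id
  map_add : ∀ s t : ℝ≥0, T (s + t) = T s ∘ₗ T t
  contraction_one : ∀ (t : ℝ≥0) (f : Lp 𝕜 1 m), eLpNorm (T t f) 1 m ≤ eLpNorm f 1 m
  contraction_top : ∀ (t : ℝ≥0) (f : Lp 𝕜 1 m), eLpNorm (T t f) ∞ m ≤ eLpNorm f ∞ m
  continuous : ∀ f : Lp 𝕜 1 m, Continuous fun t : ℝ≥0 => T t f

section Extension

variable {𝕜 : Type*} [RCLike 𝕜] {Ω : Type*} [MeasurableSpace Ω] {m : Measure Ω}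

variable (𝕜 m) in
/-- The space `L¹ ∩ L^∞`. -/
def L1Linf : Submodule 𝕜 (Lp 𝕜 1 m) where
  carrier := {f | MemLp f ∞ m}
  add_mem' {f g} hf hg := (memLp_congr_ae (Lp.coeFn_add f g)).2 (MemLp.add hf hg)
  zero_mem' := (memLp_congr_ae (Lp.coeFn_zero 𝕜 1 m)).2 MemLp.zero
  smul_mem' c f hf := (memLp_congr_ae (Lp.coeFn_smul c f)).2 (MemLp.const_smul hf c)

lemma memLp_of_one_of_top {f : Ω → 𝕜} (h1 : MemLp f 1 m) (ht : MemLp f ∞ m) (p : ℝ≥0)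
    [hp : Fact (1 ≤ (p : ℝ≥0∞))] : MemLp f p m := by
  have hp1 : (1 : ℝ) ≤ p := by exact_mod_cast hp.out
  have hp0 : (p : ℝ≥0∞) ≠ 0 := (zero_lt_one.trans_le hp.out).ne'
  refine ⟨h1.1, ?_⟩
  rw [eLpNorm_lt_top_iff_lintegral_rpow_enorm_lt_top hp0 ENNReal.coe_ne_top]
  set K := eLpNorm f ∞ m with hK
  have hle : ∀ᵐ x ∂m, ‖f x‖ₑ ^ (p : ℝ) ≤ ‖f x‖ₑ * K ^ ((p : ℝ) - 1) := by
    filter_upwards [ae_le_eLpNormEssSup (f := f) (μ := m)] with x hx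
    calc ‖f x‖ₑ ^ (p : ℝ) = ‖f x‖ₑ ^ (1 + ((p : ℝ) - 1)) := by ring_nf
      _ = ‖f x‖ₑ * ‖f x‖ₑ ^ ((p : ℝ) - 1) := by
        rw [ENNReal.rpow_add_of_nonneg _ _ zero_le_one (by linarith), ENNReal.rpow_one]
      _ ≤ _ := by
        gcongr ‖f x‖ₑ * ?_
        exact ENNReal.rpow_le_rpow (by rw [hK, eLpNorm_exponent_top]; exact hx) (by linarith)
  refine (lintegral_mono_ae hle).trans_lt ?_
  rw [lintegral_mul_const'' _ h1.1.enorm]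
  refine ENNReal.mul_lt_top ?_ (ENNReal.rpow_lt_top_of_nonneg (by linarith) ht.2.ne)
  simpa [eLpNorm_one_eq_lintegral_enorm] using h1.2

variable (𝕜 m) in
/-- The inclusion of `L¹ ∩ L^∞` into `L^p`, `1 ≤ p < ∞`. -/
def inclLp (p : ℝ≥0) [Fact (1 ≤ (p : ℝ≥0∞))] : L1Linf 𝕜 m →ₗ[𝕜] Lp 𝕜 p m where
  toFun f := (memLp_of_one_of_top (Lp.memLp f.1) f.2 p).toLp f.1
  map_add' f g := by
    rw [← MemLp.toLp_add]
    exact MemLp.toLp_congr _ _ (Lp.coeFn_add f.1 g.1)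
  map_smul' c f := by
    rw [RingHom.id_apply, ← MemLp.toLp_const_smul]
    exact MemLp.toLp_congr _ _ (Lp.coeFn_smul c f.1)

lemma coeFn_inclLp (p : ℝ≥0) [Fact (1 ≤ (p : ℝ≥0∞))] (f : L1Linf 𝕜 m) :
    inclLp 𝕜 m p f =ᵐ[m] f.1 :=
  MemLp.coeFn_toLp (memLp_of_one_of_top (Lp.memLp f.1) f.2 p)

lemma denseRange_inclLp (p : ℝ≥0) [hp : Fact (1 ≤ (p : ℝ≥0∞))] :
    DenseRange (inclLp 𝕜 m p) := by
  have hp0 : (p : ℝ≥0∞) ≠ 0 := (zero_lt_one.trans_le hp.out).ne'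
  refine (Lp.simpleFunc.dense (E := 𝕜) (μ := m) (p := p) ENNReal.coe_ne_top).mono ?_
  intro g hg
  let g' : Lp.simpleFunc 𝕜 p m := ⟨g, hg⟩
  let s := Lp.simpleFunc.toSimpleFunc g'
  have hs : MemLp s p m := Lp.simpleFunc.memLp g'
  have hs1 : MemLp s 1 m := (SimpleFunc.memLp_iff one_ne_zero ENNReal.one_ne_top).2
    ((SimpleFunc.memLp_iff hp0 ENNReal.coe_ne_top).1 hs)
  refine ⟨⟨hs1.toLp s, (memLp_congr_ae hs1.coeFn_toLp).2 (SimpleFunc.memLp_top s m)⟩, ?_⟩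
  apply Lp.ext
  exact (coeFn_inclLp p _).trans
    (hs1.coeFn_toLp.trans (Lp.simpleFunc.toSimpleFunc_eq_toFun g'))

namespace ContractionSemigroup

variable (S : ContractionSemigroup 𝕜 m)

/-- The action of `T_t` on `L¹ ∩ L^∞`. -/
def onL1Linf (t : ℝ≥0) : L1Linf 𝕜 m →ₗ[𝕜] L1Linf 𝕜 m :=
  (S.T t).restrict fun f hf =>
    ⟨(Lp.memLp (S.T t f)).1, (S.contraction_top t f).trans_lt (MemLp.eLpNorm_lt_top hf)⟩

lemma meas_lt_le (t : ℝ≥0) (f : Lp 𝕜 1 m) {l : ℝ} (hl : 0 < l) :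
    m {x | l < ‖S.T t f x‖} ≤
      ENNReal.ofReal (2 / l) * ∫⁻ x in {x | l < 2 * ‖f x‖}, ‖f x‖ₑ ∂m := by
  have hfm : Measurable f := (Lp.stronglyMeasurable f).measurable
  have hA : MeasurableSet {x | l < 2 * ‖f x‖} :=
    measurableSet_lt measurable_const (hfm.norm.const_mul 2)
  have hb : MemLp ({x | l < 2 * ‖f x‖}.indicator f) 1 m := (Lp.memLp f).indicator hA
  set b : Lp 𝕜 1 m := hb.toLp _ with hbdef
  have hbc : b =ᵐ[m] {x | l < 2 * ‖f x‖}.indicator f := hb.coeFn_toLp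
  have hsm : eLpNorm (f - b : Lp 𝕜 1 m) ∞ m ≤ ENNReal.ofReal (l / 2) := by
    rw [eLpNorm_exponent_top]
    refine eLpNormEssSup_le_of_ae_bound ?_
    filter_upwards [Lp.coeFn_sub f b, hbc] with x h1 h2
    rw [h1, Pi.sub_apply, h2]
    by_cases hx : l < 2 * ‖f x‖
    · rw [indicator_of_mem (show x ∈ {x | l < 2 * ‖f x‖} from hx)]
      simp only [sub_self, norm_zero]; positivity
    · rw [indicator_of_notMem (show x ∉ {x | l < 2 * ‖f x‖} from hx), sub_zero]
      linarith
  have hsm' : ∀ᵐ x ∂m, ‖S.T t (f - b) x‖ₑ ≤ ENNReal.ofReal (l / 2) := by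
    filter_upwards [ae_le_eLpNormEssSup (f := S.T t (f - b)) (μ := m)] with x hx
    rw [← eLpNorm_exponent_top] at hx
    exact hx.trans ((S.contraction_top t _).trans hsm)
  have hsub : ∀ᵐ x ∂m, x ∈ {x | l < ‖S.T t f x‖} →
      x ∈ {x | ENNReal.ofReal (l / 2) ≤ ‖S.T t b x‖ₑ} := by
    have heq : S.T t f = S.T t (f - b) + S.T t b := by rw [← _root_.map_add, sub_add_cancel]
    filter_upwards [hsm', Lp.coeFn_add (S.T t (f - b)) (S.T t b)] with x h1 h2 h3
    change l < ‖S.T t f x‖ at h3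
    show ENNReal.ofReal (l / 2) ≤ ‖S.T t b x‖ₑ
    rw [heq, h2, Pi.add_apply] at h3
    rw [← ofReal_norm, ENNReal.ofReal_le_ofReal_iff (by positivity)] at h1
    rw [← ofReal_norm, ENNReal.ofReal_le_ofReal_iff (norm_nonneg _)]
    have := norm_add_le (S.T t (f - b) x) (S.T t b x)
    linarith
  have hl0 : ENNReal.ofReal (l / 2) ≠ 0 := by simpa using hl
  calc m {x | l < ‖S.T t f x‖}
      ≤ m {x | ENNReal.ofReal (l / 2) ≤ ‖S.T t b x‖ₑ} := measure_mono_ae hsub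
    _ ≤ (∫⁻ x, ‖S.T t b x‖ₑ ∂m) / ENNReal.ofReal (l / 2) :=
        meas_ge_le_lintegral_div (Lp.aestronglyMeasurable _).enorm hl0 ENNReal.ofReal_ne_top
    _ ≤ (∫⁻ x, ‖b x‖ₑ ∂m) / ENNReal.ofReal (l / 2) := by
        have := S.contraction_one t b
        rw [eLpNorm_one_eq_lintegral_enorm, eLpNorm_one_eq_lintegral_enorm] at this
        gcongr
    _ = (∫⁻ x in {x | l < 2 * ‖f x‖}, ‖f x‖ₑ ∂m) / ENNReal.ofReal (l / 2) := by
        rw [← lintegral_indicator hA]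
        congr 1
        refine lintegral_congr_ae ?_
        filter_upwards [hbc] with x hx
        rw [hx, enorm_indicator_eq_indicator_enorm]
    _ = _ := by
        rw [ENNReal.div_eq_inv_mul, ← ENNReal.ofReal_inv_of_pos (by positivity), inv_div]

lemma lintegral_rpow_le (t : ℝ≥0) (f : Lp 𝕜 1 m) {p : ℝ} (hp : 1 < p) :
    ∫⁻ x, ‖S.T t f x‖ₑ ^ p ∂m ≤
      ENNReal.ofReal (p * 2 ^ p / (p - 1)) * ∫⁻ x, ‖f x‖ₑ ^ p ∂m := by
  have hp0 : 0 < p := by linarith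
  have hfm : Measurable f := (Lp.stronglyMeasurable f).measurable
  have hgm : Measurable (S.T t f) := (Lp.stronglyMeasurable _).measurable
  have hR : ∀ (r : ℝ) (_ : 0 < r) (y : 𝕜), ‖y‖ₑ ^ r = ENNReal.ofReal (‖y‖ ^ r) := by
    intro r hr y
    rw [← ofReal_norm, ENNReal.ofReal_rpow_of_nonneg (norm_nonneg _) hr.le]
  set ν : Measure Ω := m.withDensity fun x => ‖f x‖ₑ with hν
  have hA : ∀ l : ℝ, MeasurableSet {x | l < 2 * ‖f x‖} := fun l =>
    measurableSet_lt measurable_const (hfm.norm.const_mul 2)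
  have key := lintegral_rpow_eq_lintegral_meas_lt_mul ν (f := fun x => 2 * ‖f x‖)
    (Eventually.of_forall fun x => by positivity) (hfm.norm.const_mul 2).aemeasurable
    (p := p - 1) (by linarith)
  have h1 : ENNReal.ofReal (2 / (p - 1)) * ENNReal.ofReal (p - 1) = 2 := by
    rw [← ENNReal.ofReal_mul (by apply div_nonneg <;> linarith),
      div_mul_cancel₀ _ (by linarith : p - 1 ≠ 0)]
    simp
  calc ∫⁻ x, ‖S.T t f x‖ₑ ^ p ∂m = ∫⁻ x, ENNReal.ofReal (‖S.T t f x‖ ^ p) ∂m := by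
        simp only [hR p hp0]
    _ = ENNReal.ofReal p *
          ∫⁻ l in Ioi (0 : ℝ), m {x | l < ‖S.T t f x‖} * ENNReal.ofReal (l ^ (p - 1)) :=
        lintegral_rpow_eq_lintegral_meas_lt_mul m (Eventually.of_forall fun x => norm_nonneg _)
          hgm.norm.aemeasurable hp0
    _ ≤ ENNReal.ofReal p * ∫⁻ l in Ioi (0 : ℝ),
          2 * (ν {x | l < 2 * ‖f x‖} * ENNReal.ofReal (l ^ (p - 1 - 1))) := by
        gcongr ENNReal.ofReal p * ?_
        refine setLIntegral_mono' measurableSet_Ioi fun l hl => ?_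
        have hl : 0 < l := hl
        rw [hν, withDensity_apply _ (hA l)]
        refine (mul_le_mul_left (S.meas_lt_le t f hl) _).trans (le_of_eq ?_)
        rw [Real.rpow_sub_one hl.ne' (p - 1), div_eq_mul_inv 2 l, div_eq_mul_inv (l ^ (p - 1)) l,
          ENNReal.ofReal_mul zero_le_two, ENNReal.ofReal_mul (Real.rpow_nonneg hl.le _)]
        simp only [ENNReal.ofReal_ofNat]
        ring
    _ = ENNReal.ofReal p * (ENNReal.ofReal (2 / (p - 1)) *
          ∫⁻ x, ENNReal.ofReal ((2 * ‖f x‖) ^ (p - 1)) ∂ν) := by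
        rw [key, ← mul_assoc (ENNReal.ofReal (2 / (p - 1))), h1,
          lintegral_const_mul' _ _ (by simp)]
    _ = ENNReal.ofReal p * (ENNReal.ofReal (2 / (p - 1)) *
          ∫⁻ x, ENNReal.ofReal (2 ^ (p - 1)) * ‖f x‖ₑ ^ p ∂m) := by
        congr 2
        rw [hν, lintegral_withDensity_eq_lintegral_mul _ hfm.enorm
          (by fun_prop)]
        refine lintegral_congr fun x => ?_
        have hsplit : ‖f x‖ₑ ^ p = ‖f x‖ₑ * ‖f x‖ₑ ^ (p - 1) := by
          conv_lhs => rw [show p = 1 + (p - 1) by ring]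
          rw [ENNReal.rpow_add_of_nonneg _ _ zero_le_one (by linarith), ENNReal.rpow_one]
        rw [Pi.mul_apply, Real.mul_rpow zero_le_two (norm_nonneg _),
          ENNReal.ofReal_mul (by positivity), hsplit, hR (p - 1) (by linarith)]
        ring
    _ = _ := by
        rw [lintegral_const_mul' _ _ ENNReal.ofReal_ne_top, ← mul_assoc, ← mul_assoc,
          ← ENNReal.ofReal_mul hp0.le,
          ← ENNReal.ofReal_mul (mul_nonneg hp0.le (div_nonneg zero_le_two (by linarith)))]
        congr 2
        rw [Real.rpow_sub_one two_ne_zero]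
        have : p - 1 ≠ 0 := by linarith
        field_simp

lemma exists_norm_le (t : ℝ≥0) (p : ℝ≥0) [hp : Fact (1 ≤ (p : ℝ≥0∞))] :
    ∃ C : ℝ, ∀ f : L1Linf 𝕜 m,
      ‖(inclLp 𝕜 m p ∘ₗ S.onL1Linf t) f‖ ≤ C * ‖inclLp 𝕜 m p f‖ := by
  have hp0 : (p : ℝ≥0∞) ≠ 0 := (zero_lt_one.trans_le hp.out).ne'
  have hp1 : (1 : ℝ) ≤ p := by exact_mod_cast hp.out
  obtain ⟨K, hK⟩ : ∃ K : ℝ≥0, ∀ f : L1Linf 𝕜 m,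
      eLpNorm (S.T t f.1) p m ≤ K * eLpNorm f.1 p m := by
    rcases hp1.eq_or_lt with h | h
    · have : p = 1 := by exact_mod_cast h.symm
      subst this
      exact ⟨1, fun f => by simpa using S.contraction_one t f.1⟩
    · refine ⟨(p * 2 ^ (p : ℝ) / (p - 1) : ℝ).toNNReal ^ (1 / (p : ℝ)), fun f => ?_⟩
      rw [eLpNorm_eq_lintegral_rpow_enorm_toReal hp0 ENNReal.coe_ne_top,
        eLpNorm_eq_lintegral_rpow_enorm_toReal hp0 ENNReal.coe_ne_top, ENNReal.coe_toReal,
        ENNReal.coe_rpow_of_nonneg _ (by positivity),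
        ← ENNReal.mul_rpow_of_nonneg _ _ (by positivity)]
      gcongr
      exact S.lintegral_rpow_le t f.1 h
  refine ⟨K, fun f => ?_⟩
  have h1 : eLpNorm (inclLp 𝕜 m p (S.onL1Linf t f)) p m = eLpNorm (S.T t f.1) p m :=
    eLpNorm_congr_ae (coeFn_inclLp p _)
  have h2 : eLpNorm (inclLp 𝕜 m p f) p m = eLpNorm f.1 p m := eLpNorm_congr_ae (coeFn_inclLp p _)
  rw [LinearMap.comp_apply, Lp.norm_def, Lp.norm_def, ← ENNReal.coe_toReal K,
    ← ENNReal.toReal_mul]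
  refine ENNReal.toReal_mono (ENNReal.mul_ne_top ENNReal.coe_ne_top (Lp.eLpNorm_ne_top _)) ?_
  rw [h1, h2]
  exact hK f

/-- The operator `T_t` on `L^p`, `1 ≤ p < ∞`: the continuous extension of its restriction to the
dense subspace `L¹ ∩ L^∞`. -/
def onLp (p : ℝ≥0) [Fact (1 ≤ (p : ℝ≥0∞))] (t : ℝ≥0) : Lp 𝕜 p m →L[𝕜] Lp 𝕜 p m :=
  (inclLp 𝕜 m p ∘ₗ S.onL1Linf t).extendOfNorm (inclLp 𝕜 m p)

/-- `onLp` really is an extension; by density and continuity it is the only one. -/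
lemma onLp_inclLp (p : ℝ≥0) [Fact (1 ≤ (p : ℝ≥0∞))] (t : ℝ≥0) (f : L1Linf 𝕜 m) :
    S.onLp p t (inclLp 𝕜 m p f) = inclLp 𝕜 m p (S.onL1Linf t f) := by
  have hd : DenseRange (inclLp 𝕜 m p) := denseRange_inclLp p
  have hn := S.exists_norm_le t p
  have h := LinearMap.extendOfNorm_eq hd hn f
  exact h

/-- The averages `A_α f = (1/α) ∫₀^α T_t f dt` of `f ∈ L^p` (a Bochner integral in `L^p`), with
`A_0 f = f`. -/
def average (p : ℝ≥0) [Fact (1 ≤ (p : ℝ≥0∞))] (f : Lp 𝕜 p m) (α : ℝ≥0) : Lp 𝕜 p m :=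
  if α = 0 then f else (α : ℝ)⁻¹ • ∫ t in (0 : ℝ)..α, S.onLp p t.toNNReal f

/-- `u α x` is a pointwise version of `A_α f (x)`: for almost every `x` it is continuous in
`α > 0`, as is `α ↦ (1/α) ∫₀^α T_t f (x) dt`. Two such versions agree, for almost every `x`, at all
`α` simultaneously. -/
def IsAverageVersion (p : ℝ≥0) [Fact (1 ≤ (p : ℝ≥0∞))] (f : Lp 𝕜 p m) (u : ℝ≥0 → Ω → 𝕜) : Prop :=
  (∀ α, u α =ᵐ[m] S.average p f α) ∧ ∀ᵐ x ∂m, ContinuousOn (fun α => u α x) (Ioi 0)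

/-- `M` is (almost everywhere) the maximal function `M_T f = sup_{α ≥ 0} |A_α f|`. -/
def IsMaximalFunction (p : ℝ≥0) [Fact (1 ≤ (p : ℝ≥0∞))] (f : Lp 𝕜 p m) (M : Ω → ℝ≥0∞) : Prop :=
  ∃ u : ℝ≥0 → Ω → 𝕜, S.IsAverageVersion p f u ∧ ∀ᵐ x ∂m, M x = ⨆ α : ℝ≥0, ‖u α x‖ₑ

end ContractionSemigroup

/-- The norm of `L^p(ℓ^q)`, `0 < p, q < ∞`, of a sequence given by its absolute values
`g n = |f n|`. -/
def lpLqNorm (p q : ℝ≥0) (m : Measure Ω) (g : ℕ → Ω → ℝ≥0∞) : ℝ≥0∞ :=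
  (∫⁻ x, (∑' n, g n x ^ (q : ℝ)) ^ ((p : ℝ) / q) ∂m) ^ (1 / (p : ℝ))

/-- `f ∈ L^p(ℓ^q)`. (A finite norm makes the `ℓ^q` norm of `f x` finite for almost every `x`.) -/
structure MemLpLq (p q : ℝ≥0) (m : Measure Ω) (f : ℕ → Ω → 𝕜) : Prop where
  aestronglyMeasurable : ∀ n, AEStronglyMeasurable (f n) m
  norm_lt_top : lpLqNorm p q m (fun n x => ‖f n x‖ₑ) < ∞

lemma MemLpLq.memLp {p q : ℝ≥0} [hp : Fact (1 ≤ (p : ℝ≥0∞))] (hpq : p ≤ q) {f : ℕ → Ω → 𝕜}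
    (hf : MemLpLq p q m f) (n : ℕ) : MemLp (f n) p m := by
  have hp0 : (p : ℝ≥0∞) ≠ 0 := (zero_lt_one.trans_le hp.out).ne'
  have hp1 : (1 : ℝ) ≤ p := by exact_mod_cast hp.out
  have hq1 : (1 : ℝ) ≤ q := hp1.trans (by exact_mod_cast hpq)
  refine ⟨hf.aestronglyMeasurable n, lt_of_le_of_lt ?_ hf.norm_lt_top⟩
  rw [eLpNorm_eq_lintegral_rpow_enorm_toReal hp0 ENNReal.coe_ne_top, ENNReal.coe_toReal, lpLqNorm]
  gcongr with x
  calc ‖f n x‖ₑ ^ (p : ℝ) = (‖f n x‖ₑ ^ (q : ℝ)) ^ ((p : ℝ) / q) := by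
        rw [← ENNReal.rpow_mul, mul_div_cancel₀ _ (by linarith : (q : ℝ) ≠ 0)]
    _ ≤ _ := by
        gcongr
        exact ENNReal.le_tsum (f := fun k => ‖f k x‖ₑ ^ (q : ℝ)) n

end Extension

end HopfDunfordSchwartz

end

/-! For a positive operator that contracts `L¹` and `L^∞`, Hopf's maximal ergodic lemma bounds the
averages on the set where their maximum is large, and integrating over levels gives the strong type
`(p, p)` bound with constant `p / (p - 1)`. The vector-valued bound for `p ≤ q` then costs nothing.
With `θ = p / q` and `F = (∑ uₙ^q)^(1/q)`, write `uₙ = F^(1-θ) hₙ^θ`, where `∑ hₙ^p = F^p`. Averages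
against nonnegative kernels obey Hölder, so `M uₙ ≤ (M F)^(1-θ) (M hₙ)^θ`, and the scalar bound
applied to `F` and to every `hₙ` suffices.

The `T_t` need not be positive, and a positive majorant is needed. It is obtained at the level of
finite matrices: `T_t` is compressed to step functions over finitely many disjoint sets. The
absolute values of the entries of the compression form a nonnegative matrix with the same two
contraction properties (`isSubstochastic_compressMatrix`), to which
`IsSubstochastic.sum_matrixMax_lpLq_le` applies. Only finitely many orbit points enter a discrete
maximal function, so refining the sets gives the inequality for the powers of `T_t` itself
(`mixedNorm_sup_discreteAverage_le`), with the same constant.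

Continuous time reduces to discrete time by `A_{kδ} f = (1/k) ∑_{j<k} T_δ^j (A_δ f)`: the discrete
inequality for `A_δ f` along dyadic `δ → 0` controls all positive dyadic times, since `A_δ f → f` in
`L^p`. Versions continuous in `α > 0` exist by a Kolmogorov argument, because `α ↦ ∫₀^α T_t f dt` is
Lipschitz in `L^p` and `p > 1`. By continuity the dyadic times determine the supremum over `α > 0`;
the time `α = 0` adds `|f|`. -/

namespace HopfDunfordSchwartz

/-! ### From a maximal inequality to a strong type inequality -/

/-- Doob's argument: multiply the hypothesis by `l^(p-2)`, integrate over `l`, and use the layer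
cake formula for `μ` and for `f μ`. The term `∫ g^p` is not absorbed here, since it could be
infinite. -/
lemma lintegral_rpow_le_of_meas_lt_le {α : Type*} [MeasurableSpace α] (μ : Measure α)
    {f g : α → ℝ} (hf : Measurable f) (hg : Measurable g) (hg0 : ∀ x, 0 ≤ g x)
    (h : ∀ l : ℝ, 0 < l →
      ENNReal.ofReal l * μ {x | l < g x} ≤ ∫⁻ x in {x | l < g x}, ENNReal.ofReal (f x) ∂μ)
    {p : ℝ} (hp : 1 < p) :
    ENNReal.ofReal (p - 1) * ∫⁻ x, ENNReal.ofReal (g x ^ p) ∂μ ≤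
      ENNReal.ofReal p * ∫⁻ x, ENNReal.ofReal (f x) * ENNReal.ofReal (g x ^ (p - 1)) ∂μ := by
  set ν : Measure α := μ.withDensity fun x => ENNReal.ofReal (f x) with hν
  have hA : ∀ l : ℝ, MeasurableSet {x | l < g x} := fun l => measurableSet_lt measurable_const hg
  have key := lintegral_rpow_eq_lintegral_meas_lt_mul ν (f := g)
    (Eventually.of_forall hg0) hg.aemeasurable (p := p - 1) (by linarith)
  have hνg : ∫⁻ x, ENNReal.ofReal (f x) * ENNReal.ofReal (g x ^ (p - 1)) ∂μ =
      ∫⁻ x, ENNReal.ofReal (g x ^ (p - 1)) ∂ν := by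
    rw [hν, lintegral_withDensity_eq_lintegral_mul _ hf.ennreal_ofReal (by fun_prop)]
    rfl
  rw [hνg, key, lintegral_rpow_eq_lintegral_meas_lt_mul μ (Eventually.of_forall hg0)
    hg.aemeasurable (by linarith : 0 < p), mul_left_comm]
  gcongr ENNReal.ofReal p * (ENNReal.ofReal (p - 1) * ?_)
  refine setLIntegral_mono' measurableSet_Ioi fun l hl => ?_
  have hl : 0 < l := hl
  rw [hν, withDensity_apply _ (hA l)]
  calc μ {x | l < g x} * ENNReal.ofReal (l ^ (p - 1))
      = ENNReal.ofReal l * μ {x | l < g x} * ENNReal.ofReal (l ^ (p - 1 - 1)) := by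
        have : l ^ (p - 1) = l * l ^ (p - 1 - 1) := by
          rw [Real.rpow_sub_one hl.ne' (p - 1)]; field_simp
        rw [this, ENNReal.ofReal_mul hl.le]; ring
    _ ≤ _ := by gcongr; exact h l hl

/-! ### The maximal inequality for finite matrices -/

section FiniteMatrix

open Matrix

variable {ι : Type*} [Fintype ι]

/-- `b` is a matrix with nonnegative entries which acts as a contraction both on `ℓ¹(w)` and on
`ℓ^∞`. -/
structure IsSubstochastic (w : ι → ℝ) (b : Matrix ι ι ℝ) : Prop where
  weight_nonneg : ∀ i, 0 ≤ w i
  nonneg : ∀ i j, 0 ≤ b i j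
  row : ∀ i, ∑ j, b i j ≤ 1
  col : ∀ j, ∑ i, w i * b i j ≤ w j

/-- Hölder with exponents `1 / (1 - θ)` and `1 / θ`, the weight being split as `κ = κ^(1-θ) κ^θ`; `θ
= 1` is set apart because the first exponent degenerates. -/
lemma sum_mul_rpow_mul_rpow_le {κ F h : ι → ℝ} (hκ : ∀ i, 0 ≤ κ i) (hF : ∀ i, 0 ≤ F i)
    (hh : ∀ i, 0 ≤ h i) {θ : ℝ} (h0 : 0 < θ) (h1 : θ ≤ 1) :
    ∑ i, κ i * (F i ^ (1 - θ) * h i ^ θ) ≤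
      (∑ i, κ i * F i) ^ (1 - θ) * (∑ i, κ i * h i) ^ θ := by
  rcases h1.eq_or_lt with rfl | h1
  · simp
  have hθ : 0 < 1 - θ := by linarith
  have := Real.inner_le_Lp_mul_Lq_of_nonneg Finset.univ
    (f := fun i => (κ i * F i) ^ (1 - θ)) (g := fun i => (κ i * h i) ^ θ)
    (Real.holderConjugate_one_div hθ h0 (by ring))
    (fun i _ => Real.rpow_nonneg (mul_nonneg (hκ i) (hF i)) _)
    (fun i _ => Real.rpow_nonneg (mul_nonneg (hκ i) (hh i)) _)
  refine le_trans (le_of_eq (Finset.sum_congr rfl fun i _ => ?_)) (this.trans (le_of_eq ?_))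
  · rw [Real.mul_rpow (hκ i) (hF i), Real.mul_rpow (hκ i) (hh i)]
    have : κ i = κ i ^ (1 - θ) * κ i ^ θ := by
      rw [← Real.rpow_add_of_nonneg (hκ i) hθ.le h0.le]; simp
    nth_rw 1 [this]; ring
  · rw [one_div_one_div, one_div_one_div]
    congr 2
    · refine Finset.sum_congr rfl fun i _ => ?_
      rw [← Real.rpow_mul (mul_nonneg (hκ i) (hF i)), mul_one_div_cancel hθ.ne', Real.rpow_one]
    · refine Finset.sum_congr rfl fun i _ => ?_
      rw [← Real.rpow_mul (mul_nonneg (hκ i) (hh i)), mul_one_div_cancel h0.ne', Real.rpow_one]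

variable [DecidableEq ι]

/-- `1 + b + ⋯ + b ^ (n - 1)`. -/
def powerSum (b : Matrix ι ι ℝ) (n : ℕ) : Matrix ι ι ℝ := ∑ k ∈ Finset.range n, b ^ k

/-- The maximal function `max_{1 ≤ n ≤ K + 1} (1/n) ∑_{k < n} b ^ k f`. -/
noncomputable def matrixMax (b : Matrix ι ι ℝ) (K : ℕ) (f : ι → ℝ) (i : ι) : ℝ :=
  (Finset.range (K + 1)).sup' Finset.nonempty_range_add_one
    fun n => ((n : ℝ) + 1)⁻¹ * (powerSum b (n + 1) *ᵥ f) i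

lemma powerSum_succ_mulVec (b : Matrix ι ι ℝ) (n : ℕ) (f : ι → ℝ) (i : ι) :
    (powerSum b (n + 1) *ᵥ f) i = f i + ∑ j, b i j * (powerSum b n *ᵥ f) j := by
  have : powerSum b (n + 1) = b * powerSum b n + 1 := geom_sum_succ
  rw [this, Matrix.add_mulVec, Matrix.one_mulVec, ← Matrix.mulVec_mulVec, Pi.add_apply, add_comm]
  rfl

lemma powerSum_zero_mulVec (b : Matrix ι ι ℝ) (f : ι → ℝ) (i : ι) :
    (powerSum b 0 *ᵥ f) i = 0 := by
  simp [powerSum]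

variable {w : ι → ℝ} {b : Matrix ι ι ℝ}

lemma IsSubstochastic.pow_nonneg (hb : IsSubstochastic w b) (k : ℕ) (i j : ι) :
    0 ≤ (b ^ k) i j := by
  induction k generalizing i j with
  | zero => rw [pow_zero, Matrix.one_apply]; split_ifs <;> norm_num
  | succ k ih =>
    rw [pow_succ, Matrix.mul_apply]
    exact Finset.sum_nonneg fun l _ => mul_nonneg (ih i l) (hb.nonneg l j)

lemma IsSubstochastic.powerSum_nonneg (hb : IsSubstochastic w b) (n : ℕ) (i j : ι) :
    0 ≤ powerSum b n i j := by
  rw [powerSum, Matrix.sum_apply]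
  exact Finset.sum_nonneg fun k _ => hb.pow_nonneg k i j

lemma IsSubstochastic.powerSum_mulVec_nonneg (hb : IsSubstochastic w b) (n : ℕ) {f : ι → ℝ}
    (hf : ∀ i, 0 ≤ f i) (i : ι) : 0 ≤ (powerSum b n *ᵥ f) i :=
  Finset.sum_nonneg fun j _ => mul_nonneg (hb.powerSum_nonneg n i j) (hf j)

lemma matrixMax_nonneg (hb : IsSubstochastic w b) (K : ℕ) {f : ι → ℝ} (hf : ∀ i, 0 ≤ f i)
    (i : ι) : 0 ≤ matrixMax b K f i :=
  Finset.le_sup'_of_le _ (Finset.mem_range.2 K.succ_pos)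
    (mul_nonneg (by positivity) (hb.powerSum_mulVec_nonneg _ hf i))

/-- The maximal ergodic theorem of Hopf and Dunford–Schwartz for finite matrices. -/
lemma IsSubstochastic.maximal_ergodic (hb : IsSubstochastic w b) (K : ℕ) (f : ι → ℝ) {l : ℝ}
    (hl : 0 ≤ l) :
    l * ∑ i with l < matrixMax b K f i, w i ≤ ∑ i with l < matrixMax b K f i, w i * f i := by
  -- Garsia's proof. The maximum includes `n = 0`, which makes `h` nonnegative, and `h > 0` exactly
  -- where the maximal function exceeds `l`.
  set h : ι → ℝ := fun i => (Finset.range (K + 2)).sup' Finset.nonempty_range_add_one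
    fun n => (powerSum b n *ᵥ f) i - n * l with hh
  have h0 : ∀ i, 0 ≤ h i := fun i =>
    Finset.le_sup'_of_le _ (Finset.mem_range.2 (Nat.succ_pos _))
      (by rw [powerSum_zero_mulVec]; simp)
  have hpos : ∀ i, l < matrixMax b K f i ↔ 0 < h i := by
    intro i
    rw [matrixMax, Finset.lt_sup'_iff, hh, Finset.lt_sup'_iff]
    constructor
    · rintro ⟨n, hn, hln⟩
      refine ⟨n + 1, Finset.mem_range.2 (by have := Finset.mem_range.1 hn; omega), ?_⟩
      rw [lt_inv_mul_iff₀ (by positivity)] at hln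
      push_cast; linarith
    · rintro ⟨n, hn, hln⟩
      rcases n with _ | n
      · rw [powerSum_zero_mulVec] at hln; simp at hln
      · refine ⟨n, Finset.mem_range.2 (by have := Finset.mem_range.1 hn; omega), ?_⟩
        rw [lt_inv_mul_iff₀ (by positivity)]
        push_cast at hln; linarith
  -- Where `h > 0` the maximum is attained at some `n + 1`, and the sum of `n + 1` terms is `f` plus
  -- `b` applied to the sum of `n` terms, which is at most `h + n l`. The row sums and `l ≥ 0` keep
  -- `b` from enlarging the constant `n l`.
  have hrec : ∀ i, 0 < h i → h i ≤ f i - l + ∑ j, b i j * h j := by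
    intro i hi
    obtain ⟨n, hn, hin⟩ := Finset.exists_mem_eq_sup' (Finset.nonempty_range_add_one (n := K + 1))
      fun n => (powerSum b n *ᵥ f) i - n * l
    change h i = _ at hin
    rcases n with _ | n
    · rw [powerSum_zero_mulVec] at hin; simp at hin; exact absurd hin hi.ne'
    · have hle : ∀ j, (powerSum b n *ᵥ f) j ≤ h j + n * l := by
        intro j
        have := Finset.le_sup' (fun n : ℕ => (powerSum b n *ᵥ f) j - n * l)
          (Finset.mem_range.2 (by have := Finset.mem_range.1 hn; omega) : n ∈ Finset.range (K + 2))
        change _ ≤ h j at this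
        linarith
      have hsum : ∑ j, b i j * (powerSum b n *ᵥ f) j ≤ ∑ j, b i j * h j + n * l := by
        calc _ ≤ ∑ j, b i j * (h j + n * l) :=
              Finset.sum_le_sum fun j _ => mul_le_mul_of_nonneg_left (hle j) (hb.nonneg i j)
          _ = ∑ j, b i j * h j + (∑ j, b i j) * (n * l) := by
              simp only [mul_add, Finset.sum_add_distrib, Finset.sum_mul]
          _ ≤ _ := by
              have : (∑ j, b i j) * (n * l) ≤ 1 * (n * l) :=
                mul_le_mul_of_nonneg_right (hb.row i) (by positivity)
              linarith
      rw [hin, powerSum_succ_mulVec]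
      push_cast
      linarith
  simp only [hpos]
  have h1 : ∑ i with 0 < h i, w i * h i ≤ ∑ i with 0 < h i, (w i * f i - w i * l)
      + ∑ i, w i * ∑ j, b i j * h j := by
    calc _ ≤ ∑ i with 0 < h i, ((w i * f i - w i * l) + w i * ∑ j, b i j * h j) := by
          refine Finset.sum_le_sum fun i hi => ?_
          have := mul_le_mul_of_nonneg_left (hrec i (Finset.mem_filter.1 hi).2)
            (hb.weight_nonneg i)
          linarith
      _ ≤ _ := by
          rw [Finset.sum_add_distrib]
          gcongr
          · exact fun i _ _ => mul_nonneg (hb.weight_nonneg _)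
              (Finset.sum_nonneg fun j _ => mul_nonneg (hb.nonneg _ j) (h0 j))
          · exact Finset.filter_subset _ _
  -- By the column condition the total mass of `b h` is at most that of `h`, which lives on `{h >
  -- 0}`; so the terms in `h` cancel from `h1`.
  have h2 : ∑ i, w i * ∑ j, b i j * h j ≤ ∑ j, w j * h j := by
    calc ∑ i, w i * ∑ j, b i j * h j = ∑ j, (∑ i, w i * b i j) * h j := by
          simp only [Finset.mul_sum, Finset.sum_mul]
          rw [Finset.sum_comm]
          simp only [mul_assoc]
      _ ≤ _ := Finset.sum_le_sum fun j _ => mul_le_mul_of_nonneg_right (hb.col j) (h0 j)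
  have h3 : ∑ j, w j * h j = ∑ i with 0 < h i, w i * h i := by
    symm
    refine Finset.sum_filter_of_ne fun i _ hi => ?_
    exact (h0 i).lt_of_ne' (right_ne_zero_of_mul hi)
  rw [Finset.sum_sub_distrib, ← Finset.sum_mul] at h1
  linarith

lemma IsSubstochastic.sum_matrixMax_rpow_le (hb : IsSubstochastic w b) (K : ℕ) {f : ι → ℝ}
    (hf : ∀ i, 0 ≤ f i) {p : ℝ} (hp : 1 < p) :
    ∑ i, w i * matrixMax b K f i ^ p ≤ (p / (p - 1)) ^ p * ∑ i, w i * f i ^ p := by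
  let _ : MeasurableSpace ι := ⊤
  have _ : MeasurableSingletonClass ι := ⟨fun _ => trivial⟩
  set g := matrixMax b K f
  have hg0 : ∀ i, 0 ≤ g i := matrixMax_nonneg hb K hf
  have hw := hb.weight_nonneg
  set μ : Measure ι := Measure.sum fun i => ENNReal.ofReal (w i) • Measure.dirac i with hμ
  have hint : ∀ F : ι → ℝ≥0∞, ∫⁻ i, F i ∂μ = ∑ i, ENNReal.ofReal (w i) * F i := by
    intro F
    rw [hμ, lintegral_sum_measure, tsum_fintype]
    simp [lintegral_smul_measure]
  have hintR : ∀ F : ι → ℝ, (∀ i, 0 ≤ F i) →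
      ∫⁻ i, ENNReal.ofReal (F i) ∂μ = ENNReal.ofReal (∑ i, w i * F i) := by
    intro F hF
    rw [hint, ENNReal.ofReal_sum_of_nonneg fun i _ => mul_nonneg (hw i) (hF i)]
    simp only [ENNReal.ofReal_mul (hw _)]
  have hset : ∀ (l : ℝ) (F : ι → ℝ), (∀ i, 0 ≤ F i) →
      ∫⁻ i in {i | l < g i}, ENNReal.ofReal (F i) ∂μ =
        ENNReal.ofReal (∑ i with l < g i, w i * F i) := by
    intro l F hF
    have hm : MeasurableSet {i | l < g i} := trivial
    rw [← lintegral_indicator hm, Finset.sum_filter,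
      ENNReal.ofReal_sum_of_nonneg, hint]
    · refine Finset.sum_congr rfl fun i _ => ?_
      by_cases hi : l < g i
      · rw [if_pos hi, indicator_of_mem (show i ∈ {i | l < g i} from hi),
          ENNReal.ofReal_mul (hw i)]
      · rw [if_neg hi, indicator_of_notMem (show i ∉ {i | l < g i} from hi)]; simp
    · intro i _; split_ifs
      · exact mul_nonneg (hw i) (hF i)
      · exact le_rfl
  have hm : ∀ F : ι → ℝ, Measurable F := fun F _ _ => trivial
  have hmain := lintegral_rpow_le_of_meas_lt_le μ (f := f) (g := g) (hm _) (hm _) hg0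
    (fun l hl => by
      have h1 : μ {x | l < g x} = ENNReal.ofReal (∑ i with l < g i, w i) := by
        have := hset l (fun _ => 1) (fun _ => zero_le_one)
        simpa using this
      rw [h1, hset l f hf, ← ENNReal.ofReal_mul hl.le]
      exact ENNReal.ofReal_le_ofReal (hb.maximal_ergodic K f hl.le)) hp
  have hgp : ∀ i, 0 ≤ g i ^ (p - 1) := fun i => Real.rpow_nonneg (hg0 i) _
  simp only [← ENNReal.ofReal_mul (hf _)] at hmain
  rw [hintR _ fun i => Real.rpow_nonneg (hg0 i) _,
    hintR _ fun i => mul_nonneg (hf i) (hgp i),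
    ← ENNReal.ofReal_mul (by linarith), ← ENNReal.ofReal_mul (by linarith),
    ENNReal.ofReal_le_ofReal_iff (mul_nonneg (by linarith)
      (Finset.sum_nonneg fun i _ => mul_nonneg (hw i) (mul_nonneg (hf i) (hgp i))))] at hmain
  have hconj : p.HolderConjugate (p / (p - 1)) := Real.HolderConjugate.conjExponent hp
  have hp1 : 0 < p - 1 := by linarith
  -- The factor `p / (p - 1)` is put on `f`, so that `g^p` keeps the coefficient `(p - 1) / p < 1`
  -- and can be absorbed on the left. This is legitimate because the sums are finite.
  have hyoung : ∀ i, p / (p - 1) * (f i * g i ^ (p - 1)) ≤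
      (p / (p - 1)) ^ p * f i ^ p / p + g i ^ p / (p / (p - 1)) := by
    intro i
    have := Real.young_inequality_of_nonneg (a := p / (p - 1) * f i) (b := g i ^ (p - 1))
      (mul_nonneg (by positivity) (hf i)) (hgp i) hconj
    rw [Real.mul_rpow (by positivity) (hf i), ← Real.rpow_mul (hg0 i),
      mul_div_cancel₀ _ hp1.ne'] at this
    linarith
  have hsum : p / (p - 1) * ∑ i, w i * (f i * g i ^ (p - 1)) ≤
      (p / (p - 1)) ^ p * (∑ i, w i * f i ^ p) / p + (∑ i, w i * g i ^ p) / (p / (p - 1)) := by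
    rw [Finset.mul_sum, Finset.mul_sum, Finset.sum_div, Finset.sum_div, ← Finset.sum_add_distrib]
    refine Finset.sum_le_sum fun i _ => ?_
    have := mul_le_mul_of_nonneg_left (hyoung i) (hw i)
    calc _ = w i * (p / (p - 1) * (f i * g i ^ (p - 1))) := by ring
      _ ≤ _ := this
      _ = _ := by ring
  set X := ∑ i, w i * g i ^ p
  set Y := ∑ i, w i * (f i * g i ^ (p - 1))
  set Z := (p / (p - 1)) ^ p * ∑ i, w i * f i ^ p
  have h1 : X ≤ p / (p - 1) * Y := by
    rw [div_mul_eq_mul_div, le_div_iff₀ hp1]; linarith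
  have h2 : X ≤ Z / p + X / (p / (p - 1)) := h1.trans hsum
  have h3 : X / (p / (p - 1)) = X - X / p := by field_simp
  rw [h3] at h2
  have h4 : X / p ≤ Z / p := by linarith
  exact (div_le_div_iff_of_pos_right (by linarith)).1 h4

/-- Each average is a sum against a nonnegative kernel, so Hölder applies to it; both factors are
then bounded by their own maximal functions. -/
lemma matrixMax_rpow_mul_rpow_le (hb : IsSubstochastic w b) (K : ℕ) {F h : ι → ℝ}
    (hF : ∀ i, 0 ≤ F i) (hh : ∀ i, 0 ≤ h i) {θ : ℝ} (h0 : 0 < θ) (h1 : θ ≤ 1) (i : ι) :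
    matrixMax b K (fun j => F j ^ (1 - θ) * h j ^ θ) i ≤
      matrixMax b K F i ^ (1 - θ) * matrixMax b K h i ^ θ := by
  have key : ∀ (n : ℕ) (u : ι → ℝ), ((n : ℝ) + 1)⁻¹ * (powerSum b (n + 1) *ᵥ u) i =
      ∑ j, (((n : ℝ) + 1)⁻¹ * powerSum b (n + 1) i j) * u j := by
    intro n u
    rw [Matrix.mulVec, dotProduct, Finset.mul_sum]
    simp only [mul_assoc]
  refine Finset.sup'_le _ _ fun n hn => ?_
  have hκ : ∀ j, 0 ≤ ((n : ℝ) + 1)⁻¹ * powerSum b (n + 1) i j := fun j =>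
    mul_nonneg (by positivity) (hb.powerSum_nonneg _ i j)
  rw [key]
  refine (sum_mul_rpow_mul_rpow_le hκ hF hh h0 h1).trans ?_
  have hle : ∀ u : ι → ℝ,
      ∑ j, (((n : ℝ) + 1)⁻¹ * powerSum b (n + 1) i j) * u j ≤ matrixMax b K u i := by
    intro u
    rw [← key]
    exact Finset.le_sup' (fun n : ℕ => ((n : ℝ) + 1)⁻¹ * (powerSum b (n + 1) *ᵥ u) i) hn
  have hFn := Finset.sum_nonneg fun j (_ : j ∈ Finset.univ) => mul_nonneg (hκ j) (hF j)
  have hhn := Finset.sum_nonneg fun j (_ : j ∈ Finset.univ) => mul_nonneg (hκ j) (hh j)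
  exact mul_le_mul (Real.rpow_le_rpow hFn (hle F) (by linarith))
    (Real.rpow_le_rpow hhn (hle h) h0.le) (Real.rpow_nonneg hhn _)
    (Real.rpow_nonneg (hFn.trans (hle F)) _)

/-- The vector-valued maximal inequality for finite matrices. -/
lemma IsSubstochastic.sum_matrixMax_lpLq_le (hb : IsSubstochastic w b) (K : ℕ) (s : Finset ℕ)
    {u : ℕ → ι → ℝ} (hu : ∀ n i, 0 ≤ u n i) {p q : ℝ} (hp : 1 < p) (hpq : p ≤ q) :
    ∑ i, w i * (∑ n ∈ s, matrixMax b K (u n) i ^ q) ^ (p / q) ≤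
      (p / (p - 1)) ^ p * ∑ i, w i * (∑ n ∈ s, u n i ^ q) ^ (p / q) := by
  have hp0 : 0 < p := by linarith
  have hq0 : 0 < q := by linarith
  set θ := p / q with hθ
  have hθ0 : 0 < θ := by positivity
  have hθ1 : θ ≤ 1 := (div_le_one hq0).2 hpq
  set F : ι → ℝ := fun i => (∑ n ∈ s, u n i ^ q) ^ (1 / q) with hF
  have hS0 : ∀ i, 0 ≤ ∑ n ∈ s, u n i ^ q := fun i =>
    Finset.sum_nonneg fun n _ => Real.rpow_nonneg (hu n i) _
  have hF0 : ∀ i, 0 ≤ F i := fun i => Real.rpow_nonneg (hS0 i) _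
  have hFp : ∀ i, (∑ n ∈ s, u n i ^ q) ^ θ = F i ^ p := by
    intro i
    rw [hF]
    simp only
    rw [← Real.rpow_mul (hS0 i), one_div_mul_eq_div]
  have hFq : ∀ i, ∑ n ∈ s, u n i ^ q = F i ^ q := by
    intro i
    rw [hF]
    simp only
    rw [← Real.rpow_mul (hS0 i), one_div_mul_cancel hq0.ne', Real.rpow_one]
  -- Chosen so that `u n = F^(1-θ) (h n)^θ` and `∑ (h n)^p = F^p`. Where `F = 0` all `u n` vanish,
  -- and with them `h n`, whatever the value of the power of `F`.
  set h : ℕ → ι → ℝ := fun n i => u n i ^ (q / p) * F i ^ (1 - q / p) with hh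
  have hh0 : ∀ n i, 0 ≤ h n i := fun n i =>
    mul_nonneg (Real.rpow_nonneg (hu n i) _) (Real.rpow_nonneg (hF0 i) _)
  have hfac : ∀ n ∈ s, ∀ i, u n i = F i ^ (1 - θ) * h n i ^ θ := by
    intro n hn i
    have hq1 : q / p * θ = 1 := by rw [hθ]; field_simp
    have hcalc : h n i ^ θ = u n i * F i ^ (θ - 1) := by
      rw [hh]
      simp only
      rw [Real.mul_rpow (Real.rpow_nonneg (hu n i) _) (Real.rpow_nonneg (hF0 i) _),
        ← Real.rpow_mul (hu n i), ← Real.rpow_mul (hF0 i), sub_mul, hq1, one_mul, Real.rpow_one]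
    rw [hcalc]
    rcases (hF0 i).eq_or_lt with h0 | h0
    · have hz : ∑ n ∈ s, u n i ^ q = 0 := by rw [hFq, ← h0, Real.zero_rpow hq0.ne']
      rw [Finset.sum_eq_zero_iff_of_nonneg fun n _ => Real.rpow_nonneg (hu n i) _] at hz
      have := hz n hn
      rw [Real.rpow_eq_zero (hu n i) hq0.ne'] at this
      rw [this]; ring
    · rw [mul_left_comm, ← Real.rpow_add h0]; simp
  have hsum : ∀ i, ∑ n ∈ s, h n i ^ p = F i ^ p := by
    intro i
    have hcalc : ∀ n, h n i ^ p = u n i ^ q * F i ^ (p - q) := by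
      intro n
      rw [hh]
      simp only
      rw [Real.mul_rpow (Real.rpow_nonneg (hu n i) _) (Real.rpow_nonneg (hF0 i) _),
        ← Real.rpow_mul (hu n i), ← Real.rpow_mul (hF0 i), sub_mul, one_mul,
        div_mul_cancel₀ _ hp0.ne']
    simp only [hcalc]
    rw [← Finset.sum_mul, hFq]
    rcases (hF0 i).eq_or_lt with h0 | h0
    · rw [← h0, Real.zero_rpow hq0.ne', Real.zero_rpow hp0.ne', zero_mul]
    · rw [← Real.rpow_add h0]; congr 1; ring
  have hMF0 := matrixMax_nonneg hb K hF0
  have hMh0 : ∀ n i, 0 ≤ matrixMax b K (h n) i := fun n => matrixMax_nonneg hb K (hh0 n)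
  -- The pointwise Hölder bound gives `(M uₙ)^q ≤ (M F)^(q-p) (M hₙ)^p`. After summation the power
  -- `θ` leaves `(M F)^p` and `∑ (M hₙ)^p` with exponents `1 - θ` and `θ`. Weighted AM-GM separates
  -- them, and since the weights add up to `1` the scalar constant survives unchanged.
  have hpt : ∀ i, (∑ n ∈ s, matrixMax b K (u n) i ^ q) ^ θ ≤
      (1 - θ) * matrixMax b K F i ^ p + θ * ∑ n ∈ s, matrixMax b K (h n) i ^ p := by
    intro i
    have hY0 : 0 ≤ ∑ n ∈ s, matrixMax b K (h n) i ^ p :=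
      Finset.sum_nonneg fun n _ => Real.rpow_nonneg (hMh0 n i) _
    have h1 : ∑ n ∈ s, matrixMax b K (u n) i ^ q ≤
        matrixMax b K F i ^ (q - p) * ∑ n ∈ s, matrixMax b K (h n) i ^ p := by
      rw [Finset.mul_sum]
      refine Finset.sum_le_sum fun n hn => ?_
      have h2 : matrixMax b K (u n) i ≤
          matrixMax b K F i ^ (1 - θ) * matrixMax b K (h n) i ^ θ := by
        have := matrixMax_rpow_mul_rpow_le hb K hF0 (hh0 n) hθ0 hθ1 i
        rwa [← funext (hfac n hn)] at this
      refine (Real.rpow_le_rpow (matrixMax_nonneg hb K (hu n) i) h2 hq0.le).trans (le_of_eq ?_)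
      rw [Real.mul_rpow (Real.rpow_nonneg (hMF0 i) _) (Real.rpow_nonneg (hMh0 n i) _),
        ← Real.rpow_mul (hMF0 i), ← Real.rpow_mul (hMh0 n i), sub_mul, one_mul, hθ,
        div_mul_cancel₀ _ hq0.ne']
    refine (Real.rpow_le_rpow (Finset.sum_nonneg fun n _ =>
      Real.rpow_nonneg (matrixMax_nonneg hb K (hu n) i) _) h1 hθ0.le).trans ?_
    rw [Real.mul_rpow (Real.rpow_nonneg (hMF0 i) _) hY0, ← Real.rpow_mul (hMF0 i)]
    have : (q - p) * θ = p * (1 - θ) := by rw [hθ]; field_simp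
    rw [this, Real.rpow_mul (hMF0 i)]
    exact Real.geom_mean_le_arith_mean2_weighted (by linarith) hθ0.le
      (Real.rpow_nonneg (hMF0 i) _) hY0 (by ring)
  have hw := hb.weight_nonneg
  have hA := hb.sum_matrixMax_rpow_le K hF0 hp
  have hB : ∑ i, w i * ∑ n ∈ s, matrixMax b K (h n) i ^ p ≤
      (p / (p - 1)) ^ p * ∑ i, w i * F i ^ p := by
    calc _ = ∑ n ∈ s, ∑ i, w i * matrixMax b K (h n) i ^ p := by
          simp only [Finset.mul_sum]; rw [Finset.sum_comm]
      _ ≤ ∑ n ∈ s, (p / (p - 1)) ^ p * ∑ i, w i * h n i ^ p :=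
          Finset.sum_le_sum fun n _ => hb.sum_matrixMax_rpow_le K (hh0 n) hp
      _ = _ := by
          rw [← Finset.mul_sum, Finset.sum_comm]
          simp only [← Finset.mul_sum, hsum]
  simp only [hFp]
  calc _ ≤ ∑ i, ((1 - θ) * (w i * matrixMax b K F i ^ p) +
        θ * (w i * ∑ n ∈ s, matrixMax b K (h n) i ^ p)) := by
        refine Finset.sum_le_sum fun i _ => ?_
        have := mul_le_mul_of_nonneg_left (hpt i) (hw i)
        linarith
    _ = (1 - θ) * ∑ i, w i * matrixMax b K F i ^ p +
        θ * ∑ i, w i * ∑ n ∈ s, matrixMax b K (h n) i ^ p := by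
        rw [Finset.sum_add_distrib, ← Finset.mul_sum, ← Finset.mul_sum]
    _ ≤ (1 - θ) * ((p / (p - 1)) ^ p * ∑ i, w i * F i ^ p) +
        θ * ((p / (p - 1)) ^ p * ∑ i, w i * F i ^ p) := by
        gcongr
    _ = _ := by ring

end FiniteMatrix

/-! ### The norm of `L^p(ℓ^q)` for finite families -/

section MixedNorm

variable {Ω : Type*} [MeasurableSpace Ω] {m : Measure Ω}

/-- The norm of `L^p(ℓ^q)` of the finite family `(g n)_{n ∈ s}`. -/
noncomputable def mixedNorm (p q : ℝ) (m : Measure Ω) (s : Finset ℕ) (g : ℕ → Ω → ℝ≥0∞) : ℝ≥0∞ :=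
  (∫⁻ x, ((∑ n ∈ s, g n x ^ q) ^ (1 / q)) ^ p ∂m) ^ (1 / p)

lemma aemeasurable_finset_lqNorm {q : ℝ} {s : Finset ℕ} {g : ℕ → Ω → ℝ≥0∞}
    (hg : ∀ n ∈ s, AEMeasurable (g n) m) :
    AEMeasurable (fun x => (∑ n ∈ s, g n x ^ q) ^ (1 / q)) m :=
  (Finset.aemeasurable_fun_sum s fun n hn => (hg n hn).pow_const q).pow_const _

variable {p q : ℝ}

lemma mixedNorm_mono_ae (hp : 0 < p) (hq : 0 < q) {s : Finset ℕ} {g h : ℕ → Ω → ℝ≥0∞}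
    (H : ∀ n ∈ s, ∀ᵐ x ∂m, g n x ≤ h n x) : mixedNorm p q m s g ≤ mixedNorm p q m s h := by
  have H' : ∀ᵐ x ∂m, ∀ n ∈ s, g n x ≤ h n x := (Finset.eventually_all s).2 H
  unfold mixedNorm
  refine ENNReal.rpow_le_rpow (lintegral_mono_ae ?_) (by positivity)
  filter_upwards [H'] with x hx
  gcongr with n hn
  exact hx n hn

lemma mixedNorm_congr_ae {s : Finset ℕ} {g h : ℕ → Ω → ℝ≥0∞}
    (H : ∀ n ∈ s, g n =ᵐ[m] h n) : mixedNorm p q m s g = mixedNorm p q m s h := by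
  have H' : ∀ᵐ x ∂m, ∀ n ∈ s, g n x = h n x := (Finset.eventually_all s).2 H
  unfold mixedNorm
  congr 1
  refine lintegral_congr_ae ?_
  filter_upwards [H'] with x hx
  rw [Finset.sum_congr rfl fun n hn => by rw [hx n hn]]

lemma mixedNorm_add_le (hp : 1 ≤ p) (hq : 1 ≤ q) {s : Finset ℕ} {g h : ℕ → Ω → ℝ≥0∞}
    (hg : ∀ n ∈ s, AEMeasurable (g n) m) (hh : ∀ n ∈ s, AEMeasurable (h n) m) :
    mixedNorm p q m s (fun n x => g n x + h n x) ≤ mixedNorm p q m s g + mixedNorm p q m s h := by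
  refine le_trans (ENNReal.rpow_le_rpow (lintegral_mono fun x => ?_) (by positivity))
    (ENNReal.lintegral_Lp_add_le (aemeasurable_finset_lqNorm hg) (aemeasurable_finset_lqNorm hh) hp)
  exact ENNReal.rpow_le_rpow (ENNReal.Lp_add_le s (fun n => g n x) (fun n => h n x) hq)
    (by positivity)

/-- The `ℓ^q` norm is at most the `ℓ¹` norm, and Minkowski does the rest. The bound is crude, but it
serves only for error terms that tend to zero. -/
lemma mixedNorm_le_sum (hp : 1 ≤ p) (hq : 1 ≤ q) {s : Finset ℕ} {g : ℕ → Ω → ℝ≥0∞}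
    (hg : ∀ n ∈ s, AEMeasurable (g n) m) :
    mixedNorm p q m s g ≤ ∑ n ∈ s, (∫⁻ x, g n x ^ p ∂m) ^ (1 / p) := by
  have hp0 : 0 < p := by linarith
  have hq0 : 0 < q := by linarith
  induction s using Finset.cons_induction with
  | empty => simp [mixedNorm, hp0, hq0]
  | cons a s ha ih =>
    rw [Finset.sum_cons]
    have hs : ∀ n ∈ s, AEMeasurable (g n) m := fun n hn => hg n (Finset.mem_cons_of_mem hn)
    refine le_trans ?_ (add_le_add_right (ih hs) _)
    refine le_trans (ENNReal.rpow_le_rpow (lintegral_mono fun x => ?_) (by positivity))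
      (ENNReal.lintegral_Lp_add_le (hg a (Finset.mem_cons_self a s))
        (aemeasurable_finset_lqNorm hs) hp)
    refine ENNReal.rpow_le_rpow ?_ hp0.le
    rw [Finset.sum_cons, Pi.add_apply]
    have := ENNReal.rpow_add_rpow_le_add (g a x) ((∑ n ∈ s, g n x ^ q) ^ (1 / q)) hq
    rwa [← ENNReal.rpow_mul, one_div_mul_cancel hq0.ne', ENNReal.rpow_one] at this

lemma mixedNorm_le_add_sum (hp : 1 ≤ p) (hq : 1 ≤ q) {s : Finset ℕ} {g h d : ℕ → Ω → ℝ≥0∞}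
    (hh : ∀ n ∈ s, AEMeasurable (h n) m) (hd : ∀ n ∈ s, AEMeasurable (d n) m)
    (H : ∀ n ∈ s, ∀ᵐ x ∂m, g n x ≤ h n x + d n x) :
    mixedNorm p q m s g ≤ mixedNorm p q m s h + ∑ n ∈ s, (∫⁻ x, d n x ^ p ∂m) ^ (1 / p) :=
  (mixedNorm_mono_ae (by linarith) (by linarith) H).trans
    ((mixedNorm_add_le hp hq hh hd).trans (add_le_add_right (mixedNorm_le_sum hp hq hd) _))

/-- Fatou's lemma, in the form that carries uniform bounds to pointwise limits. -/
lemma lintegral_le_of_tendsto_ae {F : ℕ → Ω → ℝ≥0∞} {G : Ω → ℝ≥0∞} {B : ℝ≥0∞}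
    (hF : ∀ j, AEMeasurable (F j) m) (h : ∀ᵐ x ∂m, Tendsto (fun j => F j x) atTop (𝓝 (G x)))
    (hB : ∀ j, ∫⁻ x, F j x ∂m ≤ B) : ∫⁻ x, G x ∂m ≤ B :=
  calc ∫⁻ x, G x ∂m = ∫⁻ x, liminf (fun j => F j x) atTop ∂m := by
        refine lintegral_congr_ae ?_
        filter_upwards [h] with x hx using hx.liminf_eq.symm
    _ ≤ liminf (fun j => ∫⁻ x, F j x ∂m) atTop := lintegral_liminf_le' hF
    _ ≤ B := (liminf_le_liminf (Eventually.of_forall hB)).trans (by simp)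

lemma mixedNorm_le_of_tendsto (hp : 0 < p) {s : Finset ℕ} {g : ℕ → ℕ → Ω → ℝ≥0∞}
    {G : ℕ → Ω → ℝ≥0∞} {B : ℝ≥0∞} (hg : ∀ j, ∀ n ∈ s, AEMeasurable (g j n) m)
    (h : ∀ n ∈ s, ∀ᵐ x ∂m, Tendsto (fun j => g j n x) atTop (𝓝 (G n x)))
    (hB : ∀ j, mixedNorm p q m s (g j) ≤ B) : mixedNorm p q m s G ≤ B := by
  unfold mixedNorm at hB ⊢
  simp only [one_div p] at hB ⊢
  rw [ENNReal.rpow_inv_le_iff hp]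
  refine lintegral_le_of_tendsto_ae (fun j => (aemeasurable_finset_lqNorm (hg j)).pow_const p) ?_
    fun j => (ENNReal.rpow_inv_le_iff hp).1 (hB j)
  filter_upwards [(Finset.eventually_all s).2 h] with x hx
  refine ((ENNReal.continuous_rpow_const.tendsto _).comp
    ((ENNReal.continuous_rpow_const.tendsto _).comp
      (tendsto_finsetSum s fun n hn => (ENNReal.continuous_rpow_const.tendsto _).comp (hx n hn))))

lemma lpLqNorm_eq (p q : ℝ≥0) (g : ℕ → Ω → ℝ≥0∞) :
    lpLqNorm p q m g = (∫⁻ x, ((∑' n, g n x ^ (q : ℝ)) ^ (1 / (q : ℝ))) ^ (p : ℝ) ∂m) ^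
      (1 / (p : ℝ)) := by
  unfold lpLqNorm
  simp only [← ENNReal.rpow_mul, one_div_mul_eq_div]

lemma mixedNorm_le_lpLqNorm (p q : ℝ≥0) (s : Finset ℕ) (g : ℕ → Ω → ℝ≥0∞) :
    mixedNorm p q m s g ≤ lpLqNorm p q m g := by
  rw [lpLqNorm_eq, mixedNorm]
  gcongr
  exact ENNReal.sum_le_tsum s

lemma lpLqNorm_le_of_forall_mixedNorm_le {p : ℝ≥0} (q : ℝ≥0) (hp : 0 < p) {g : ℕ → Ω → ℝ≥0∞}
    {B : ℝ≥0∞} (hg : ∀ n, AEMeasurable (g n) m)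
    (hB : ∀ N, mixedNorm p q m (Finset.range N) g ≤ B) : lpLqNorm p q m g ≤ B := by
  have hp : 0 < (p : ℝ) := hp
  rw [lpLqNorm_eq]
  unfold mixedNorm at hB
  simp only [one_div (p : ℝ)] at hB ⊢
  rw [ENNReal.rpow_inv_le_iff hp]
  refine lintegral_le_of_tendsto_ae (fun j => (aemeasurable_finset_lqNorm
    (s := Finset.range j) fun n _ => hg n).pow_const (p : ℝ)) ?_
    fun j => (ENNReal.rpow_inv_le_iff hp).1 (hB j)
  refine Eventually.of_forall fun x => ?_
  exact (ENNReal.continuous_rpow_const.tendsto _).comp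
    ((ENNReal.continuous_rpow_const.tendsto _).comp (ENNReal.tendsto_nat_tsum _))

end MixedNorm

/-! ### The semigroup and its averages on `L^p` -/

section Semigroup

variable {𝕜 : Type*} [RCLike 𝕜] {Ω : Type*} [MeasurableSpace Ω] {m : Measure Ω}

lemma eLpNorm_le_of_eLpNorm_top_le {p : ℝ} (hp : 1 ≤ p) {f : Ω → 𝕜}
    (hf : AEStronglyMeasurable f m) {K : ℝ≥0∞} (hK : eLpNorm f ∞ m ≤ K) :
    eLpNorm f (ENNReal.ofReal p) m ≤ (eLpNorm f 1 m * K ^ (p - 1)) ^ (1 / p) := by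
  have hp0 : ENNReal.ofReal p ≠ 0 := by simpa using (by linarith : 0 < p)
  rw [eLpNorm_eq_lintegral_rpow_enorm_toReal hp0 ENNReal.ofReal_ne_top,
    ENNReal.toReal_ofReal (by linarith)]
  gcongr
  rw [eLpNorm_one_eq_lintegral_enorm, ← lintegral_mul_const'' _ hf.enorm]
  refine lintegral_mono_ae ?_
  filter_upwards [ae_le_eLpNormEssSup (f := f) (μ := m)] with x hx
  calc ‖f x‖ₑ ^ p = ‖f x‖ₑ ^ (1 + (p - 1)) := by ring_nf
    _ = ‖f x‖ₑ * ‖f x‖ₑ ^ (p - 1) := by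
      rw [ENNReal.rpow_add_of_nonneg _ _ zero_le_one (by linarith), ENNReal.rpow_one]
    _ ≤ _ := by
      gcongr
      rw [← eLpNorm_exponent_top] at hx
      exact hx.trans hK

namespace ContractionSemigroup

/-- A bound for the norms of the operators `T_t` on `L^p`, `1 < p < ∞`. -/
noncomputable def opBound (p : ℝ≥0) : ℝ := (p * 2 ^ (p : ℝ) / (p - 1) : ℝ) ^ (1 / (p : ℝ))

lemma opBound_nonneg {p : ℝ≥0} (hp : 1 < p) : 0 ≤ opBound p := by
  have hp1 : (1 : ℝ) < p := by exact_mod_cast hp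
  exact Real.rpow_nonneg (div_nonneg (by positivity) (by linarith)) _

variable (S : ContractionSemigroup 𝕜 m) {p : ℝ≥0} [Fact (1 ≤ (p : ℝ≥0∞))]

/-- The interpolation bound `lintegral_rpow_le` extends from the dense subspace by closedness. Its
value is immaterial: only uniformity in `t` matters, and it does not enter the final constant. -/
lemma norm_onLp_le (hp : 1 < p) (t : ℝ≥0) (f : Lp 𝕜 p m) :
    ‖S.onLp p t f‖ ≤ opBound p * ‖f‖ := by
  have hp1 : (1 : ℝ) < p := by exact_mod_cast hp
  have hp0 : (p : ℝ≥0∞) ≠ 0 := by exact_mod_cast (zero_lt_one.trans hp).ne'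
  refine (denseRange_inclLp p).induction_on
    (p := fun f => ‖S.onLp p t f‖ ≤ opBound p * ‖f‖) f
    (isClosed_le (by fun_prop) (by fun_prop)) fun g => ?_
  have h0 : 0 ≤ (p * 2 ^ (p : ℝ) / (p - 1) : ℝ) := div_nonneg (by positivity) (by linarith)
  rw [onLp_inclLp, Lp.norm_def, Lp.norm_def, ← ENNReal.toReal_ofReal (opBound_nonneg hp),
    ← ENNReal.toReal_mul]
  refine ENNReal.toReal_mono (ENNReal.mul_ne_top ENNReal.ofReal_ne_top (Lp.eLpNorm_ne_top _)) ?_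
  rw [eLpNorm_congr_ae (coeFn_inclLp p _), eLpNorm_congr_ae (coeFn_inclLp p g),
    eLpNorm_eq_lintegral_rpow_enorm_toReal hp0 ENNReal.coe_ne_top,
    eLpNorm_eq_lintegral_rpow_enorm_toReal hp0 ENNReal.coe_ne_top, ENNReal.coe_toReal, opBound,
    ← ENNReal.ofReal_rpow_of_nonneg h0 (by positivity),
    ← ENNReal.mul_rpow_of_nonneg _ _ (by positivity)]
  gcongr
  exact S.lintegral_rpow_le t g.1 hp1

lemma onLp_zero : S.onLp p 0 = ContinuousLinearMap.id 𝕜 (Lp 𝕜 p m) := by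
  refine DFunLike.coe_injective ((denseRange_inclLp p).equalizer (by fun_prop) (by fun_prop) ?_)
  funext g
  rw [Function.comp_apply, onLp_inclLp, Function.comp_apply, ContinuousLinearMap.id_apply]
  congr 1
  exact Subtype.ext (by change S.T 0 g.1 = g.1; rw [S.map_zero]; rfl)

lemma onLp_add (s t : ℝ≥0) : S.onLp p (s + t) = S.onLp p s ∘L S.onLp p t := by
  refine DFunLike.coe_injective ((denseRange_inclLp p).equalizer (by fun_prop) (by fun_prop) ?_)
  funext g
  rw [Function.comp_apply, onLp_inclLp, Function.comp_apply, ContinuousLinearMap.comp_apply,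
    onLp_inclLp, onLp_inclLp]
  congr 1
  exact Subtype.ext (by change S.T (s + t) g.1 = S.T s (S.T t g.1); rw [S.map_add]; rfl)

lemma onLp_nat_mul (k : ℕ) (t : ℝ≥0) : S.onLp p (k * t) = S.onLp p t ^ k := by
  induction k with
  | zero => simp [onLp_zero]; rfl
  | succ k ih => rw [Nat.cast_succ, add_mul, one_mul, onLp_add, ih, pow_succ]; rfl

/-- Continuity in `L¹` interpolates with the uniform bound `‖T_s g - T_t g‖_∞ ≤ 2 ‖g‖_∞`, because
`|h|^p ≤ |h| ‖h‖_∞^(p-1)`. -/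
lemma continuous_onLp_inclLp (g : L1Linf 𝕜 m) :
    Continuous fun t : ℝ≥0 => S.onLp p t (inclLp 𝕜 m p g) := by
  have hp1 : (1 : ℝ) ≤ p := by exact_mod_cast (Fact.out : 1 ≤ (p : ℝ≥0∞))
  simp only [onLp_inclLp]
  set K : ℝ≥0∞ := 2 * eLpNorm g.1 ∞ m with hK
  have hKt : K ≠ ∞ := ENNReal.mul_ne_top (by simp) (MemLp.eLpNorm_lt_top g.2).ne
  have hle : ∀ s t, edist (inclLp 𝕜 m p (S.onL1Linf s g)) (inclLp 𝕜 m p (S.onL1Linf t g)) ≤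
      (edist (S.T s g.1) (S.T t g.1) * K ^ ((p : ℝ) - 1)) ^ (1 / (p : ℝ)) := by
    intro s t
    rw [Lp.edist_def, Lp.edist_def]
    have h1 : ⇑(inclLp 𝕜 m p (S.onL1Linf s g)) - ⇑(inclLp 𝕜 m p (S.onL1Linf t g)) =ᵐ[m]
        ⇑(S.T s g.1) - ⇑(S.T t g.1) :=
      (coeFn_inclLp p (S.onL1Linf s g)).sub (coeFn_inclLp p (S.onL1Linf t g))
    have h2 := eLpNorm_le_of_eLpNorm_top_le hp1 (m := m) (K := K)
      (f := ⇑(S.T s g.1) - ⇑(S.T t g.1))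
      ((Lp.aestronglyMeasurable _).sub (Lp.aestronglyMeasurable _)) (by
        refine (eLpNorm_sub_le (Lp.aestronglyMeasurable _) (Lp.aestronglyMeasurable _)
          (by simp)).trans ?_
        rw [hK, two_mul]
        exact add_le_add (S.contraction_top s _) (S.contraction_top t _))
    rw [ENNReal.ofReal_coe_nnreal] at h2
    rw [eLpNorm_congr_ae h1]
    exact h2
  rw [continuous_iff_continuousAt]
  intro t
  rw [ContinuousAt, tendsto_iff_edist_tendsto_0]
  have h3 : Tendsto (fun s => (edist (S.T s g.1) (S.T t g.1) * K ^ ((p : ℝ) - 1)) ^ (1 / (p : ℝ)))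
      (𝓝 t) (𝓝 0) := by
    have h4 := (tendsto_iff_edist_tendsto_0).1 ((S.continuous g.1).tendsto t)
    have h5 := ENNReal.Tendsto.mul_const (b := K ^ ((p : ℝ) - 1)) h4
      (Or.inr (ENNReal.rpow_ne_top_of_nonneg (by linarith) hKt))
    have h6 := (ENNReal.continuous_rpow_const (y := 1 / (p : ℝ))).tendsto _ |>.comp h5
    rw [zero_mul, ENNReal.zero_rpow_of_pos (by positivity)] at h6
    exact h6
  exact tendsto_of_tendsto_of_tendsto_of_le_of_le tendsto_const_nhds h3 (fun _ => zero_le)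
    fun s => hle s t

/-- The semigroup is strongly continuous on `L^p`, `1 < p < ∞`. -/
lemma continuous_onLp (hp : 1 < p) (f : Lp 𝕜 p m) : Continuous fun t : ℝ≥0 => S.onLp p t f := by
  refine continuous_of_uniform_approx_of_continuous fun u hu => ?_
  obtain ⟨ε, hε, hu⟩ := Metric.mem_uniformity_dist.1 hu
  have hC := opBound_nonneg hp
  obtain ⟨g, hg⟩ := (denseRange_inclLp p).exists_dist_lt f (ε := ε / (opBound p + 1))
    (by positivity)
  refine ⟨_, S.continuous_onLp_inclLp g, fun t => hu ?_⟩
  rw [dist_eq_norm, ← map_sub]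
  rw [dist_eq_norm] at hg
  refine (S.norm_onLp_le hp t _).trans_lt ?_
  rw [lt_div_iff₀ (by positivity)] at hg
  have : opBound p * ‖f - inclLp 𝕜 m p g‖ ≤ ‖f - inclLp 𝕜 m p g‖ * (opBound p + 1) := by
    nlinarith [norm_nonneg (f - inclLp 𝕜 m p g)]
  linarith

lemma continuous_onLp_toNNReal (hp : 1 < p) (f : Lp 𝕜 p m) :
    Continuous fun t : ℝ => S.onLp p t.toNNReal f :=
  (S.continuous_onLp hp f).comp continuous_real_toNNReal

lemma intervalIntegrable_onLp (hp : 1 < p) (f : Lp 𝕜 p m) (a b : ℝ) :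
    IntervalIntegrable (fun t : ℝ => S.onLp p t.toNNReal f) volume a b :=
  (S.continuous_onLp_toNNReal hp f).intervalIntegrable a b

/-- The integral over `[0, kδ]` is a sum of translates of the integral over `[0, δ]`. -/
lemma integral_onLp_nat_mul (hp : 1 < p) (f : Lp 𝕜 p m) (δ : ℝ≥0) (k : ℕ) :
    ∫ t in (0 : ℝ)..(k * δ : ℝ), S.onLp p t.toNNReal f =
      ∑ j ∈ Finset.range k, (S.onLp p δ ^ j) (∫ t in (0 : ℝ)..δ, S.onLp p t.toNNReal f) := by
  have h := intervalIntegral.sum_integral_adjacent_intervals (μ := volume) (n := k)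
    (f := fun t : ℝ => S.onLp p t.toNNReal f) (a := fun j : ℕ => (j : ℝ) * δ)
    fun j _ => S.intervalIntegrable_onLp hp f _ _
  simp only [Nat.cast_zero, zero_mul] at h
  rw [← h]
  refine Finset.sum_congr rfl fun j _ => ?_
  rw [← onLp_nat_mul, ← ContinuousLinearMap.intervalIntegral_comp_comm _
    (S.intervalIntegrable_onLp hp f _ _)]
  have h1 := intervalIntegral.integral_comp_add_left (a := 0) (b := (δ : ℝ))
    (fun t : ℝ => S.onLp p t.toNNReal f) ((j : ℝ) * δ)
  have h2 : (j : ℝ) * δ + δ = ((j + 1 : ℕ) : ℝ) * δ := by push_cast; ring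
  rw [add_zero, h2] at h1
  rw [← h1]
  refine intervalIntegral.integral_congr fun t ht => ?_
  rw [uIcc_of_le δ.coe_nonneg] at ht
  change S.onLp p ((j : ℝ) * δ + t).toNNReal f = S.onLp p (j * δ) (S.onLp p t.toNNReal f)
  have h3 : ((j : ℝ) * δ).toNNReal = j * δ := by
    rw [← NNReal.coe_natCast, ← NNReal.coe_mul, Real.toNNReal_coe]
  rw [Real.toNNReal_add (by positivity) ht.1, onLp_add, h3]
  rfl

lemma average_of_pos (f : Lp 𝕜 p m) {α : ℝ≥0} (hα : 0 < α) :
    S.average p f α = (α : ℝ)⁻¹ • ∫ t in (0 : ℝ)..α, S.onLp p t.toNNReal f :=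
  if_neg hα.ne'

lemma average_zero (f : Lp 𝕜 p m) : S.average p f 0 = f := if_pos rfl

/-- The averages over `[0, kδ]` are discrete averages of `A_δ f`. -/
lemma average_nat_mul (hp : 1 < p) (f : Lp 𝕜 p m) {δ : ℝ≥0} (hδ : 0 < δ) {k : ℕ} (hk : 0 < k) :
    S.average p f (k * δ) =
      (k : ℝ)⁻¹ • ∑ j ∈ Finset.range k, (S.onLp p δ ^ j) (S.average p f δ) := by
  have hk' : (0 : ℝ≥0) < k := by exact_mod_cast hk
  rw [S.average_of_pos f (mul_pos hk' hδ), S.average_of_pos f hδ, NNReal.coe_mul,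
    NNReal.coe_natCast, S.integral_onLp_nat_mul hp, mul_inv, mul_smul, Finset.smul_sum]
  congr 1
  refine Finset.sum_congr rfl fun j _ => ?_
  rw [ContinuousLinearMap.map_smul_of_tower]

/-- The averages are the difference quotients at `0` of `α ↦ ∫₀^α T_t f dt`, whose derivative there
is `T_0 f = f`. -/
lemma tendsto_average (hp : 1 < p) (f : Lp 𝕜 p m) {δ : ℕ → ℝ≥0} (hδ : ∀ j, 0 < δ j)
    (hδ0 : Tendsto δ atTop (𝓝 0)) :
    Tendsto (fun j => S.average p f (δ j)) atTop (𝓝 f) := by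
  have hc := S.continuous_onLp_toNNReal hp f
  have hd := intervalIntegral.integral_hasDerivAt_right (S.intervalIntegrable_onLp hp f 0 0)
    (hc.stronglyMeasurableAtFilter _ _) hc.continuousAt
  rw [hasDerivAt_iff_tendsto_slope_zero] at hd
  simp only [zero_add, intervalIntegral.integral_same, sub_zero, Real.toNNReal_zero, onLp_zero,
    ContinuousLinearMap.id_apply] at hd
  have h0 : Tendsto (fun j => (δ j : ℝ)) atTop (𝓝[≠] 0) := by
    refine tendsto_nhdsWithin_iff.2 ⟨?_, Eventually.of_forall fun j => ?_⟩
    · have := (NNReal.tendsto_coe.2 hδ0); simpa using this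
    · simpa using (hδ j).ne'
  refine (hd.comp h0).congr fun j => ?_
  rw [S.average_of_pos f (hδ j)]; rfl

end ContractionSemigroup

end Semigroup

/-! ### Continuous versions of Lipschitz paths in `L^p` -/

section Version

/-- The largest point `≤ t` of the grid `2⁻ʲ ℕ`. -/
noncomputable def dyadicFloor (j : ℕ) (t : ℝ≥0) : ℝ≥0 := (⌊t * 2 ^ j⌋₊ : ℝ≥0) / 2 ^ j

lemma dyadicFloor_le (j : ℕ) (t : ℝ≥0) : dyadicFloor j t ≤ t := by
  rw [dyadicFloor, div_le_iff₀ (by positivity)]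
  exact Nat.floor_le zero_le

lemma dist_dyadicFloor_le (j : ℕ) (t : ℝ≥0) : dist (dyadicFloor j t) t ≤ (1 / 2) ^ j := by
  have h1 : (dyadicFloor j t : ℝ) ≤ t := by exact_mod_cast dyadicFloor_le j t
  have h2 : (t : ℝ) * 2 ^ j < ⌊t * 2 ^ j⌋₊ + 1 := by
    exact_mod_cast Nat.lt_floor_add_one (t * 2 ^ j)
  have h3 : (dyadicFloor j t : ℝ) = (⌊t * 2 ^ j⌋₊ : ℝ) / 2 ^ j := by simp [dyadicFloor]
  rw [NNReal.dist_eq, abs_sub_comm, abs_of_nonneg (by linarith), h3, one_div, inv_pow,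
    ← one_div, le_div_iff₀ (by positivity), sub_mul, div_mul_cancel₀ _ (by positivity)]
  linarith

lemma tendsto_dyadicFloor (t : ℝ≥0) : Tendsto (fun j => dyadicFloor j t) atTop (𝓝 t) := by
  rw [tendsto_iff_dist_tendsto_zero]
  exact squeeze_zero (fun _ => dist_nonneg) (fun j => dist_dyadicFloor_le j t)
    (tendsto_pow_atTop_nhds_zero_of_lt_one (by norm_num) (by norm_num))

variable {E : Type*} [NormedAddCommGroup E]

/-- A function whose increments over the dyadic intervals of `[0, j]` of length `2⁻ʲ` are bounded
by a geometric sequence agrees on the dyadic numbers with a continuous function. -/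
lemma exists_continuous_of_dyadic_increments [CompleteSpace E] {ψ : ℝ≥0 → E} {K τ : ℝ}
    (hK : 0 ≤ K) (hτ0 : 0 ≤ τ) (hτ1 : τ < 1)
    (h : ∀ j k : ℕ, k < j * 2 ^ j →
      ‖ψ (((k + 1 : ℕ) : ℝ≥0) / 2 ^ j) - ψ ((k : ℝ≥0) / 2 ^ j)‖ ≤ K * τ ^ j) :
    ∃ v : ℝ≥0 → E, Continuous v ∧
      ∀ t, Tendsto (fun j => ψ (dyadicFloor j t)) atTop (𝓝 (v t)) := by
  have hfloor : ∀ (j N : ℕ) (t : ℝ≥0), t < N → N ≤ j → ⌊t * 2 ^ j⌋₊ < j * 2 ^ j := by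
    intro j N t ht hN
    rw [Nat.floor_lt zero_le]
    push_cast
    have : (N : ℝ≥0) ≤ j := by exact_mod_cast hN
    exact mul_lt_mul_of_pos_right (ht.trans_le this) (by positivity)
  -- The floor of index `a` at level `j` has index `2 a` at level `j + 1`, where the finer floor has
  -- index `2 a` or `2 a + 1`: at most one increment separates them. The condition `t < N ≤ j` keeps
  -- `t` in the range `[0, j]` of the hypothesis.
  have hstep : ∀ (j N : ℕ) (t : ℝ≥0), t < N → N ≤ j →
      dist (ψ (dyadicFloor j t)) (ψ (dyadicFloor (j + 1) t)) ≤ K * τ ^ j := by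
    intro j N t ht hN
    have h1 := hfloor (j + 1) N t ht (by omega)
    have hj := hfloor j N t ht hN
    set a := ⌊t * 2 ^ j⌋₊ with ha
    have hda : dyadicFloor j t = ((2 * a : ℕ) : ℝ≥0) / 2 ^ (j + 1) := by
      rw [dyadicFloor, ← ha]; push_cast; field_simp; ring
    have h2 : 2 * a ≤ ⌊t * 2 ^ (j + 1)⌋₊ := by
      refine Nat.le_floor ?_
      have := Nat.floor_le (zero_le : 0 ≤ t * 2 ^ j)
      push_cast
      calc (2 : ℝ≥0) * a ≤ 2 * (t * 2 ^ j) := by gcongr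
        _ = _ := by ring
    have h3 : ⌊t * 2 ^ (j + 1)⌋₊ < 2 * a + 2 := by
      rw [Nat.floor_lt zero_le]
      have := Nat.lt_floor_add_one (t * 2 ^ j)
      push_cast
      calc t * 2 ^ (j + 1) = 2 * (t * 2 ^ j) := by ring
        _ < 2 * (a + 1) := by gcongr
        _ = _ := by ring
    rw [hda]
    have hKτ : K * τ ^ (j + 1) ≤ K * τ ^ j :=
      mul_le_mul_of_nonneg_left (pow_le_pow_of_le_one hτ0 hτ1.le (Nat.le_succ j)) hK
    rcases (by omega : ⌊t * 2 ^ (j + 1)⌋₊ = 2 * a ∨ ⌊t * 2 ^ (j + 1)⌋₊ = 2 * a + 1) with h4 | h4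
    · rw [dyadicFloor, h4, dist_self]; positivity
    · rw [dyadicFloor, h4, dist_comm, dist_eq_norm]
      exact (h (j + 1) (2 * a) (by omega)).trans hKτ
  have hlim : ∀ t : ℝ≥0, ∃ y, Tendsto (fun j => ψ (dyadicFloor j t)) atTop (𝓝 y) := by
    intro t
    obtain ⟨N, hN⟩ := exists_nat_gt t
    have hc : CauchySeq fun j => ψ (dyadicFloor (j + N) t) := by
      refine cauchySeq_of_le_geometric τ (K * τ ^ N) hτ1 fun j => ?_
      have := hstep (j + N) N t hN (by omega)
      rw [pow_add, ← mul_assoc, mul_right_comm, add_right_comm] at this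
      exact this
    obtain ⟨y, hy⟩ := cauchySeq_tendsto_of_complete hc
    exact ⟨y, (tendsto_add_atTop_iff_nat N).1 hy⟩
  choose v hv using hlim
  refine ⟨v, ?_, hv⟩
  have hdist : ∀ (j N : ℕ) (t : ℝ≥0), t < N → N ≤ j →
      dist (ψ (dyadicFloor j t)) (v t) ≤ K * τ ^ j / (1 - τ) := by
    intro j N t ht hN
    have := dist_le_of_le_geometric_of_tendsto₀ τ (K * τ ^ j) hτ1
      (f := fun i => ψ (dyadicFloor (i + j) t)) (fun i => by
        have := hstep (i + j) N t ht (by omega)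
        rw [pow_add, ← mul_assoc, mul_right_comm, add_right_comm] at this
        exact this) ((tendsto_add_atTop_iff_nat j).2 (hv t))
    simpa using this
  have hgrid : ∀ (j N : ℕ) (s t : ℝ≥0), s ≤ t → t < N → N ≤ j → (t : ℝ) - s < (1 / 2) ^ j →
      dist (ψ (dyadicFloor j s)) (ψ (dyadicFloor j t)) ≤ K * τ ^ j := by
    intro j N s t hst ht hN hd
    have h1 := hfloor j N s (hst.trans_lt ht) hN
    have h2 : ⌊s * 2 ^ j⌋₊ ≤ ⌊t * 2 ^ j⌋₊ := Nat.floor_le_floor (by gcongr)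
    have h3 : ⌊t * 2 ^ j⌋₊ < ⌊s * 2 ^ j⌋₊ + 2 := by
      rw [Nat.floor_lt zero_le, ← NNReal.coe_lt_coe]
      have h4 : (s : ℝ) * 2 ^ j < ⌊s * 2 ^ j⌋₊ + 1 := by
        exact_mod_cast Nat.lt_floor_add_one (s * 2 ^ j)
      have h5 : ((t : ℝ) - s) * 2 ^ j < 1 := by
        calc _ < (1 / 2 : ℝ) ^ j * 2 ^ j := by gcongr
          _ = 1 := by rw [← mul_pow]; norm_num
      push_cast
      linarith
    rcases (by omega : ⌊t * 2 ^ j⌋₊ = ⌊s * 2 ^ j⌋₊ ∨ ⌊t * 2 ^ j⌋₊ = ⌊s * 2 ^ j⌋₊ + 1)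
      with h4 | h4
    · rw [dyadicFloor, dyadicFloor, h4, dist_self]; positivity
    · rw [dyadicFloor, dyadicFloor, h4, dist_comm, dist_eq_norm]
      exact h j _ h1
  -- Points closer than `2⁻ʲ` have equal or adjacent floors, so the path is compared through its two
  -- values on the grid; both tails are geometric.
  have hmod : ∀ (j N : ℕ) (s t : ℝ≥0), s ≤ t → t < N → N ≤ j → (t : ℝ) - s < (1 / 2) ^ j →
      dist (v s) (v t) ≤ K * (2 / (1 - τ) + 1) * τ ^ j := by
    intro j N s t hst ht hN hd
    have h1 := hdist j N s (hst.trans_lt ht) hN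
    have h2 := hdist j N t ht hN
    have h3 := hgrid j N s t hst ht hN hd
    have h4 := dist_triangle4 (v s) (ψ (dyadicFloor j s)) (ψ (dyadicFloor j t)) (v t)
    rw [dist_comm (v s) (ψ _)] at h4
    have : K * (2 / (1 - τ) + 1) * τ ^ j = K * τ ^ j / (1 - τ) + K * τ ^ j + K * τ ^ j / (1 - τ) := by
      ring
    linarith
  rw [Metric.continuous_iff]
  intro t ε hε
  obtain ⟨N, hN⟩ := exists_nat_gt (t + 1)
  have hz : Tendsto (fun j : ℕ => K * (2 / (1 - τ) + 1) * τ ^ j) atTop (𝓝 0) := by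
    simpa using (tendsto_pow_atTop_nhds_zero_of_lt_one hτ0 hτ1).const_mul (K * (2 / (1 - τ) + 1))
  obtain ⟨j, hj, hjN⟩ := ((hz.eventually_lt_const hε).and (eventually_ge_atTop N)).exists
  refine ⟨(1 / 2) ^ j, by positivity, fun s hs => ?_⟩
  rw [NNReal.dist_eq] at hs
  have h1 : (1 / 2 : ℝ) ^ j ≤ 1 := pow_le_one₀ (by norm_num) (by norm_num)
  have hsN : s < N := by
    refine lt_trans ?_ hN
    rw [← NNReal.coe_lt_coe]; push_cast
    linarith [le_abs_self ((s : ℝ) - t)]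
  have htN : t < N := lt_of_le_of_lt (le_add_of_nonneg_right zero_le) hN
  rcases le_total s t with hst | hst
  · exact (hmod j N s t hst htN hjN (by linarith [neg_le_abs ((s : ℝ) - t)])).trans_lt hj
  · rw [dist_comm]
    exact (hmod j N t s hst hsN hjN (by linarith [le_abs_self ((s : ℝ) - t)])).trans_lt hj

variable {Ω : Type*} [MeasurableSpace Ω] {m : Measure Ω}

/-- Kolmogorov's criterion. Level `j` has `j 2ʲ` increments, each with `p`-th moment at most `(C
2⁻ʲ)^p`, and `j 2ʲ 2^(-jp)` is summable for `p > 1` with geometric room to spare. -/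
lemma ae_exists_dyadic_increments_le {p : ℝ≥0} [Fact (1 ≤ (p : ℝ≥0∞))] (hp : 1 < p)
    {Ψ : ℝ≥0 → Lp E p m} {C : ℝ≥0} (hΨ : LipschitzWith C Ψ) :
    ∃ τ : ℝ, 0 ≤ τ ∧ τ < 1 ∧ ∀ᵐ x ∂m, ∃ K : ℝ, 0 ≤ K ∧ ∀ j k : ℕ, k < j * 2 ^ j →
      ‖Ψ (((k + 1 : ℕ) : ℝ≥0) / 2 ^ j) x - Ψ ((k : ℝ≥0) / 2 ^ j) x‖ ≤ K * τ ^ j := by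
  have hp1 : (1 : ℝ) < p := by exact_mod_cast hp
  have hpp : 0 < (p : ℝ) := by linarith
  have hp0 : (p : ℝ≥0∞) ≠ 0 := by exact_mod_cast (zero_lt_one.trans hp).ne'
  -- The square root of the decay ratio `2^(1-p)`: one factor `κʲ` pays for the weight `κ⁻ʲ` in `W`,
  -- the other makes the integral of `W` converge. Finiteness of `W x` then gives increments at most
  -- `(W x)^(1/p) κ^(j/p)`.
  set κ : ℝ := 2 ^ ((1 - (p : ℝ)) / 2) with hκ
  have hκ0 : 0 < κ := by positivity
  have hκ1 : κ < 1 := Real.rpow_lt_one_of_one_lt_of_neg (by norm_num) (by linarith)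
  have hκκ : κ * κ = 2 * 2⁻¹ ^ (p : ℝ) := by
    rw [hκ, ← Real.rpow_add (by norm_num), add_halves, Real.rpow_sub (by norm_num), Real.rpow_one,
      Real.inv_rpow (by norm_num)]
    rfl
  clear_value κ
  set d : ℕ → ℕ → Ω → ℝ≥0∞ := fun j k x =>
    ‖Ψ (((k + 1 : ℕ) : ℝ≥0) / 2 ^ j) x - Ψ ((k : ℝ≥0) / 2 ^ j) x‖ₑ ^ (p : ℝ) with hd
  have hdm : ∀ j k, AEMeasurable (d j k) m := fun j k =>
    (((Lp.aestronglyMeasurable _).sub (Lp.aestronglyMeasurable _)).enorm).pow_const _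
  have hdint : ∀ j k, ∫⁻ x, d j k x ∂m ≤ ENNReal.ofReal ((C * 2⁻¹ ^ j) ^ (p : ℝ)) := by
    intro j k
    have h1 : ∫⁻ x, d j k x ∂m =
        edist (Ψ (((k + 1 : ℕ) : ℝ≥0) / 2 ^ j)) (Ψ ((k : ℝ≥0) / 2 ^ j)) ^ (p : ℝ) := by
      rw [Lp.edist_def, eLpNorm_eq_lintegral_rpow_enorm_toReal hp0 ENNReal.coe_ne_top,
        ENNReal.coe_toReal, ← ENNReal.rpow_mul, one_div_mul_cancel hpp.ne', ENNReal.rpow_one]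
      rfl
    rw [h1, ← ENNReal.ofReal_rpow_of_nonneg (by positivity) hpp.le]
    refine ENNReal.rpow_le_rpow ?_ hpp.le
    rw [edist_dist]
    refine ENNReal.ofReal_le_ofReal ((hΨ.dist_le_mul _ _).trans (le_of_eq ?_))
    rw [NNReal.dist_eq]
    have : ((((k + 1 : ℕ) : ℝ≥0) / 2 ^ j : ℝ≥0) : ℝ) - (((k : ℝ≥0) / 2 ^ j : ℝ≥0) : ℝ) =
        2⁻¹ ^ j := by
      push_cast; rw [inv_pow]; field_simp; ring
    rw [this, abs_of_nonneg (by positivity)]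
  obtain ⟨W, hW⟩ : ∃ W : Ω → ℝ≥0∞, W = fun x =>
      ∑' j : ℕ, ENNReal.ofReal (κ⁻¹ ^ j) * ∑ k ∈ Finset.range (j * 2 ^ j), d j k x := ⟨_, rfl⟩
  have hWm : ∀ j, AEMeasurable
      (fun x => ENNReal.ofReal (κ⁻¹ ^ j) * ∑ k ∈ Finset.range (j * 2 ^ j), d j k x) m := fun j =>
    (Finset.aemeasurable_fun_sum _ fun k _ => hdm j k).const_mul _
  have hsummable : Summable fun j : ℕ => (C : ℝ) ^ (p : ℝ) * ((j : ℝ) ^ 1 * κ ^ j) := by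
    have hκn : ‖κ‖ < 1 := by rwa [Real.norm_eq_abs, abs_of_pos hκ0]
    exact (summable_pow_mul_geometric_of_norm_lt_one 1 hκn).mul_left _
  have hWint : ∫⁻ x, W x ∂m ≠ ∞ := by
    rw [hW, lintegral_tsum hWm]
    refine ne_top_of_le_ne_top hsummable.tsum_ofReal_ne_top (ENNReal.tsum_le_tsum fun j => ?_)
    rw [lintegral_const_mul'' _ (Finset.aemeasurable_fun_sum _ fun k _ => hdm j k),
      lintegral_finsetSum' _ fun k _ => hdm j k]
    calc _ ≤ ENNReal.ofReal (κ⁻¹ ^ j) * ∑ k ∈ Finset.range (j * 2 ^ j),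
          ENNReal.ofReal ((C * 2⁻¹ ^ j) ^ (p : ℝ)) := by
          gcongr with k hk
          exact hdint j k
      _ = ENNReal.ofReal (κ⁻¹ ^ j * ((j * 2 ^ j : ℕ) * (C * 2⁻¹ ^ j) ^ (p : ℝ))) := by
          rw [Finset.sum_const, Finset.card_range, nsmul_eq_mul,
            ENNReal.ofReal_mul (by positivity : (0 : ℝ) ≤ κ⁻¹ ^ j),
            ENNReal.ofReal_mul (by positivity), ENNReal.ofReal_natCast]
      _ = _ := by
          congr 1
          rw [Real.mul_rpow C.coe_nonneg (by positivity), ← Real.rpow_natCast_mul (by norm_num),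
            mul_comm (j : ℝ), Real.rpow_mul_natCast (by norm_num)]
          push_cast
          have : κ ^ j * κ ^ j = 2 ^ j * (2⁻¹ ^ (p : ℝ)) ^ j := by
            rw [← mul_pow, ← mul_pow, hκκ]
          have h5 : κ⁻¹ ^ j * (2 ^ j * (2⁻¹ ^ (p : ℝ)) ^ j) = κ ^ j := by
            rw [← this, inv_pow]; field_simp
          calc _ = (j : ℝ) * (C : ℝ) ^ (p : ℝ) * (κ⁻¹ ^ j * (2 ^ j * (2⁻¹ ^ (p : ℝ)) ^ j)) := by
                ring
            _ = _ := by rw [h5]; ring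
  have hWfin : ∀ᵐ x ∂m, W x < ∞ := ae_lt_top' (hW ▸ AEMeasurable.tsum hWm) hWint
  refine ⟨κ ^ (1 / (p : ℝ)), by positivity, Real.rpow_lt_one hκ0.le hκ1 (by positivity), ?_⟩
  filter_upwards [hWfin] with x hx
  refine ⟨(W x).toReal ^ (1 / (p : ℝ)), by positivity, fun j k hk => ?_⟩
  have h1 : ENNReal.ofReal (κ⁻¹ ^ j) * d j k x ≤ W x := by
    rw [hW]
    exact (mul_le_mul_right (Finset.single_le_sum (f := fun k => d j k x) (fun _ _ => zero_le)
      (Finset.mem_range.2 hk)) _).trans (ENNReal.le_tsum j)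
  have h2 := ENNReal.toReal_mono hx.ne h1
  set y := Ψ (((k + 1 : ℕ) : ℝ≥0) / 2 ^ j) x - Ψ ((k : ℝ≥0) / 2 ^ j) x with hy
  have h3 : (d j k x).toReal = ‖y‖ ^ (p : ℝ) := by
    rw [hd]
    simp only
    rw [← hy, ← ENNReal.toReal_rpow, toReal_enorm]
  rw [ENNReal.toReal_mul, ENNReal.toReal_ofReal (by positivity), h3, inv_pow,
    inv_mul_le_iff₀ (by positivity)] at h2
  have h4 := Real.rpow_le_rpow (by positivity) h2 (by positivity : 0 ≤ 1 / (p : ℝ))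
  rw [← Real.rpow_mul (norm_nonneg _), mul_one_div_cancel hpp.ne', Real.rpow_one,
    Real.mul_rpow (by positivity) ENNReal.toReal_nonneg, mul_comm] at h4
  rwa [← Real.rpow_mul_natCast hκ0.le, mul_comm (1 / (p : ℝ)), Real.rpow_natCast_mul hκ0.le]

/-- A Lipschitz path in `L^p`, `p > 1`, has a version with continuous trajectories. -/
lemma exists_continuous_version [CompleteSpace E] {p : ℝ≥0} [Fact (1 ≤ (p : ℝ≥0∞))] (hp : 1 < p)
    {Ψ : ℝ≥0 → Lp E p m} {C : ℝ≥0} (hΨ : LipschitzWith C Ψ) :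
    ∃ v : ℝ≥0 → Ω → E, (∀ t, v t =ᵐ[m] Ψ t) ∧ ∀ᵐ x ∂m, Continuous fun t => v t x := by
  obtain ⟨τ, hτ0, hτ1, hτ⟩ := ae_exists_dyadic_increments_le hp hΨ
  have hpath : ∀ᵐ x ∂m, ∃ v : ℝ≥0 → E, Continuous v ∧
      ∀ t, Tendsto (fun j => Ψ (dyadicFloor j t) x) atTop (𝓝 (v t)) := by
    filter_upwards [hτ] with x ⟨K, hK, hx⟩
    exact exists_continuous_of_dyadic_increments (ψ := fun t => Ψ t x) hK hτ0 hτ1 hx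
  classical
  refine ⟨fun t x => if hx : ∃ v : ℝ≥0 → E, Continuous v ∧
      ∀ t, Tendsto (fun j => Ψ (dyadicFloor j t) x) atTop (𝓝 (v t)) then hx.choose t else 0,
    fun t => ?_, ?_⟩
  -- Convergence in `L^p` gives a subsequence converging almost everywhere to `Ψ t`, which must be
  -- the pointwise limit along the dyadic floors.
  · have ht : Tendsto (fun j => Ψ (dyadicFloor j t)) atTop (𝓝 (Ψ t)) :=
      (hΨ.continuous.tendsto t).comp (tendsto_dyadicFloor t)
    obtain ⟨ns, hns, hae⟩ := (tendstoInMeasure_of_tendsto_Lp ht).exists_seq_tendsto_ae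
    filter_upwards [hpath, hae] with x hx hx'
    rw [dif_pos hx]
    exact tendsto_nhds_unique ((hx.choose_spec.2 t).comp hns.tendsto_atTop) hx'
  · filter_upwards [hpath] with x hx
    simp only [dif_pos hx]
    exact hx.choose_spec.1

end Version

universe u

/-! ### Averaging over finite families of disjoint sets -/

/-- A finite family of disjoint measurable sets of finite measure. -/
structure DisjointFamily {Ω : Type*} [MeasurableSpace Ω] (m : Measure Ω) (ι : Type*) where
  set : ι → Set Ω
  measurableSet : ∀ i, MeasurableSet (set i)
  measure_ne_top : ∀ i, m (set i) ≠ ∞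
  disjoint : ∀ i j, i ≠ j → Disjoint (set i) (set j)

namespace DisjointFamily

variable {𝕜 : Type*} [RCLike 𝕜] {Ω : Type*} [MeasurableSpace Ω] {m : Measure Ω}
variable {ι : Type*} (A : DisjointFamily m ι)

/-- The mean values of `f` over the sets of the family. -/
noncomputable def means (f : Ω → 𝕜) (i : ι) : 𝕜 :=
  (m.real (A.set i))⁻¹ • ∫ x in A.set i, f x ∂m

lemma means_congr_ae {f g : Ω → 𝕜} (h : f =ᵐ[m] g) : A.means f = A.means g := by
  funext i
  rw [means, means, integral_congr_ae (ae_restrict_of_ae h)]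

lemma integrableOn_of_memLp {r : ℝ≥0∞} (hr : 1 ≤ r) {f : Ω → 𝕜} (hf : MemLp f r m) (i : ι) :
    IntegrableOn f (A.set i) m := by
  have : IsFiniteMeasure (m.restrict (A.set i)) :=
    ⟨by rw [Measure.restrict_apply_univ]; exact (A.measure_ne_top i).lt_top⟩
  exact (hf.restrict (A.set i)).integrable hr

variable {p : ℝ≥0} [Fact (1 ≤ (p : ℝ≥0∞))]

variable (𝕜 p) in
/-- The mean values, as a linear map on `L^p`. -/
noncomputable def meansLp : Lp 𝕜 p m →ₗ[𝕜] (ι → 𝕜) where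
  toFun f := A.means f
  map_add' f g := by
    rw [A.means_congr_ae (Lp.coeFn_add f g)]
    funext i
    simp only [means, Pi.add_apply]
    rw [integral_add (A.integrableOn_of_memLp Fact.out (Lp.memLp f) i)
      (A.integrableOn_of_memLp Fact.out (Lp.memLp g) i), smul_add]
  map_smul' a f := by
    rw [A.means_congr_ae (Lp.coeFn_smul a f)]
    funext i
    simp only [means, Pi.smul_apply, RingHom.id_apply]
    rw [integral_smul, smul_comm]

lemma meansLp_apply (f : Lp 𝕜 p m) : A.meansLp 𝕜 p f = A.means f := rfl

/-- Jensen's inequality on one set, obtained by comparing the `L¹` and `L^p` norms there. -/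
lemma measure_mul_enorm_means_rpow_le (f : Lp 𝕜 p m) (i : ι) :
    m (A.set i) * ‖A.means f i‖ₑ ^ (p : ℝ) ≤ ∫⁻ x in A.set i, ‖f x‖ₑ ^ (p : ℝ) ∂m := by
  have hp1 : (1 : ℝ) ≤ p := by exact_mod_cast (Fact.out : 1 ≤ (p : ℝ≥0∞))
  have hp0 : (p : ℝ≥0∞) ≠ 0 := (zero_lt_one.trans_le (Fact.out : 1 ≤ (p : ℝ≥0∞))).ne'
  have hpp : 0 < (p : ℝ) := by linarith
  rcases eq_or_ne (m (A.set i)) 0 with h0 | h0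
  · rw [h0, zero_mul]; exact zero_le
  have ht := A.measure_ne_top i
  set w := m (A.set i) with hw
  have h1 : ‖A.means f i‖ₑ ≤ w⁻¹ * ∫⁻ x in A.set i, ‖f x‖ₑ ∂m := by
    rw [means, enorm_smul]
    refine mul_le_mul' (le_of_eq ?_) (enorm_integral_le_lintegral_enorm _)
    rw [Real.enorm_eq_ofReal (by positivity), Measure.real, ← hw, ENNReal.ofReal_inv_of_pos
      (ENNReal.toReal_pos h0 ht), ENNReal.ofReal_toReal ht]
  have h2 := eLpNorm_le_eLpNorm_mul_rpow_measure_univ (μ := m.restrict (A.set i))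
    (Fact.out : 1 ≤ (p : ℝ≥0∞)) (Lp.aestronglyMeasurable f).restrict
  rw [eLpNorm_one_eq_lintegral_enorm, Measure.restrict_apply_univ, ENNReal.toReal_one,
    ENNReal.coe_toReal, ← hw, eLpNorm_eq_lintegral_rpow_enorm_toReal hp0 ENNReal.coe_ne_top,
    ENNReal.coe_toReal] at h2
  set I := ∫⁻ x in A.set i, ‖f x‖ₑ ^ (p : ℝ) ∂m
  calc w * ‖A.means f i‖ₑ ^ (p : ℝ)
      ≤ w * (w⁻¹ * (I ^ (1 / (p : ℝ)) * w ^ (1 / 1 - 1 / (p : ℝ)))) ^ (p : ℝ) := by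
        gcongr
        exact h1.trans (by gcongr)
    _ = (w ^ (1 : ℝ) * w ^ (-(p : ℝ)) * w ^ ((p : ℝ) - 1)) * I := by
        rw [ENNReal.mul_rpow_of_nonneg _ _ hpp.le, ENNReal.mul_rpow_of_nonneg _ _ hpp.le,
          ← ENNReal.rpow_mul, ← ENNReal.rpow_mul, one_div_mul_cancel hpp.ne', ENNReal.rpow_one,
          ENNReal.rpow_one, ENNReal.inv_rpow, ← ENNReal.rpow_neg, sub_mul,
          one_div_mul_cancel hpp.ne']
        simp only [div_one, one_mul]
        ring
    _ = I := by
        rw [← ENNReal.rpow_add _ _ h0 ht, ← ENNReal.rpow_add _ _ h0 ht]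
        have : (1 : ℝ) + -(p : ℝ) + (p - 1) = 0 := by ring
        rw [this, ENNReal.rpow_zero, one_mul]

variable [Fintype ι]

/-- The step function with value `c i` on the `i`-th set, and `0` outside all sets. -/
noncomputable def stepFun {M : Type*} [AddCommMonoid M] (c : ι → M) (x : Ω) : M :=
  ∑ i, (A.set i).indicator (fun _ => c i) x

variable {M : Type*} [AddCommMonoid M]

lemma stepFun_of_mem (c : ι → M) {i : ι} {x : Ω} (hx : x ∈ A.set i) : A.stepFun c x = c i := by
  rw [stepFun, Finset.sum_eq_single i, indicator_of_mem hx]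
  · intro j _ hj
    exact indicator_of_notMem (fun h => (disjoint_left.1 (A.disjoint j i hj)) h hx) _
  · simp

lemma stepFun_of_notMem (c : ι → M) {x : Ω} (hx : ∀ i, x ∉ A.set i) : A.stepFun c x = 0 :=
  Finset.sum_eq_zero fun i _ => indicator_of_notMem (hx i) _

lemma map_stepFun {N : Type*} [AddCommMonoid N] (φ : M → N) (h0 : φ 0 = 0) (c : ι → M) (x : Ω) :
    φ (A.stepFun c x) = A.stepFun (fun i => φ (c i)) x := by
  by_cases hx : ∃ i, x ∈ A.set i
  · obtain ⟨i, hi⟩ := hx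
    rw [A.stepFun_of_mem _ hi, A.stepFun_of_mem _ hi]
  · push Not at hx
    rw [A.stepFun_of_notMem _ hx, A.stepFun_of_notMem _ hx, h0]

lemma lintegral_stepFun (c : ι → ℝ≥0∞) : ∫⁻ x, A.stepFun c x ∂m = ∑ i, m (A.set i) * c i := by
  unfold stepFun
  rw [lintegral_finsetSum _ fun i _ => measurable_const.indicator (A.measurableSet i)]
  refine Finset.sum_congr rfl fun i _ => ?_
  rw [lintegral_indicator_const (A.measurableSet i), mul_comm]

lemma memLp_stepFun (r : ℝ≥0∞) (c : ι → 𝕜) : MemLp (A.stepFun c) r m :=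
  memLp_finsetSum _ fun i _ => memLp_indicator_const r (A.measurableSet i) (c i)
    (Or.inr (A.measure_ne_top i))

variable (𝕜) in
/-- Step functions, as elements of `L¹ ∩ L^∞`. -/
noncomputable def embed : (ι → 𝕜) →ₗ[𝕜] L1Linf 𝕜 m where
  toFun c := ⟨(A.memLp_stepFun 1 c).toLp _,
    (memLp_congr_ae (A.memLp_stepFun 1 c).coeFn_toLp).2 (A.memLp_stepFun ∞ c)⟩
  map_add' c d := by
    refine Subtype.ext ?_
    change (A.memLp_stepFun 1 (c + d)).toLp _ =
      (A.memLp_stepFun 1 c).toLp _ + (A.memLp_stepFun 1 d).toLp _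
    rw [← MemLp.toLp_add]
    congr 1
    funext x
    simp only [stepFun, Pi.add_apply, ← Finset.sum_add_distrib]
    exact Finset.sum_congr rfl fun i _ => congrFun (indicator_add _ (fun _ => c i) fun _ => d i) x
  map_smul' a c := by
    refine Subtype.ext ?_
    change (A.memLp_stepFun 1 (a • c)).toLp _ = a • (A.memLp_stepFun 1 c).toLp _
    rw [← MemLp.toLp_const_smul]
    congr 1
    funext x
    simp only [stepFun, Pi.smul_apply, Finset.smul_sum]
    exact Finset.sum_congr rfl fun i _ => congrFun (indicator_const_smul _ a fun _ => c i) x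

lemma coeFn_embed (c : ι → 𝕜) : (A.embed 𝕜 c).1 =ᵐ[m] A.stepFun c :=
  (A.memLp_stepFun 1 c).coeFn_toLp

lemma coeFn_inclLp_embed (c : ι → 𝕜) :
    inclLp 𝕜 m p (A.embed 𝕜 c) =ᵐ[m] A.stepFun c :=
  (coeFn_inclLp p _).trans (A.coeFn_embed c)

lemma norm_inclLp_embed_means_le (f : Lp 𝕜 p m) :
    ‖inclLp 𝕜 m p (A.embed 𝕜 (A.means f))‖ ≤ ‖f‖ := by
  have hp0 : (p : ℝ≥0∞) ≠ 0 := (zero_lt_one.trans_le (Fact.out : 1 ≤ (p : ℝ≥0∞))).ne'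
  have hpp : 0 < (p : ℝ) := by exact_mod_cast pos_iff_ne_zero.2 hp0
  rw [Lp.norm_def, Lp.norm_def]
  refine ENNReal.toReal_mono (Lp.eLpNorm_ne_top f) ?_
  rw [eLpNorm_congr_ae (A.coeFn_inclLp_embed _),
    eLpNorm_eq_lintegral_rpow_enorm_toReal hp0 ENNReal.coe_ne_top,
    eLpNorm_eq_lintegral_rpow_enorm_toReal hp0 ENNReal.coe_ne_top, ENNReal.coe_toReal]
  refine ENNReal.rpow_le_rpow ?_ (by positivity)
  calc ∫⁻ x, ‖A.stepFun (A.means f) x‖ₑ ^ (p : ℝ) ∂m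
      = ∫⁻ x, A.stepFun (fun i => ‖A.means f i‖ₑ ^ (p : ℝ)) x ∂m := by
        refine lintegral_congr fun x => ?_
        exact A.map_stepFun (fun y : 𝕜 => ‖y‖ₑ ^ (p : ℝ)) (by simp [hpp]) _ x
    _ = ∑ i, m (A.set i) * ‖A.means f i‖ₑ ^ (p : ℝ) := A.lintegral_stepFun _
    _ ≤ ∑ i, ∫⁻ x in A.set i, ‖f x‖ₑ ^ (p : ℝ) ∂m :=
        Finset.sum_le_sum fun i _ => A.measure_mul_enorm_means_rpow_le f i
    _ = ∫⁻ x in ⋃ i, A.set i, ‖f x‖ₑ ^ (p : ℝ) ∂m := by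
        rw [lintegral_iUnion A.measurableSet fun i j hij => A.disjoint i j hij, tsum_fintype]
    _ ≤ _ := setLIntegral_le_lintegral _ _

lemma inclLp_embed_means_stepFun {f : Lp 𝕜 p m} {c : ι → 𝕜} (hf : f =ᵐ[m] A.stepFun c) :
    inclLp 𝕜 m p (A.embed 𝕜 (A.means f)) = f := by
  refine Lp.ext ((A.coeFn_inclLp_embed _).trans (EventuallyEq.trans ?_ hf.symm))
  -- On a null set of the family the mean takes the default value `0` and may miss `c i`; almost no
  -- point notices.
  have h0 : ∀ i, ∀ᵐ x ∂m, x ∈ A.set i → m (A.set i) ≠ 0 := by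
    intro i
    by_cases hi : m (A.set i) = 0
    · filter_upwards [measure_eq_zero_iff_ae_notMem.1 hi] with x hx hx' using absurd hx' hx
    · exact Eventually.of_forall fun _ _ => hi
  filter_upwards [ae_all_iff.2 h0] with x hx
  by_cases hxe : ∃ i, x ∈ A.set i
  · obtain ⟨i, hi⟩ := hxe
    rw [A.stepFun_of_mem _ hi, A.stepFun_of_mem _ hi, means,
      integral_congr_ae (ae_restrict_of_ae hf), setIntegral_congr_fun (A.measurableSet i)
        (g := fun _ => c i) fun y hy => A.stepFun_of_mem c hy, setIntegral_const, smul_smul,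
      inv_mul_cancel₀, one_smul]
    exact (ENNReal.toReal_pos (hx i hi) (A.measure_ne_top i)).ne'
  · push Not at hxe
    rw [A.stepFun_of_notMem _ hxe, A.stepFun_of_notMem _ hxe]

/-- The averaging operator `P` fixes `s`, so `P f - f = P (f - s) - (f - s)`, and `P` is a
contraction of `L^p`. -/
lemma norm_inclLp_embed_means_sub_le {f s : Lp 𝕜 p m} {c : ι → 𝕜} (hs : s =ᵐ[m] A.stepFun c) :
    ‖inclLp 𝕜 m p (A.embed 𝕜 (A.means f)) - f‖ ≤ 2 * ‖f - s‖ := by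
  have h1 : inclLp 𝕜 m p (A.embed 𝕜 (A.means f)) - f =
      inclLp 𝕜 m p (A.embed 𝕜 (A.means (f - s : Lp 𝕜 p m))) - (f - s) := by
    rw [← meansLp_apply (p := p), ← meansLp_apply (p := p), map_sub, map_sub, map_sub,
      meansLp_apply, meansLp_apply, A.inclLp_embed_means_stepFun hs]
    abel
  rw [h1, two_mul]
  exact (norm_sub_le _ _).trans (add_le_add_left (A.norm_inclLp_embed_means_le _) _)

end DisjointFamily

/-- Finitely many functions in `L^p` are approximated simultaneously by their mean values over the
sets of some finite family. -/
lemma exists_disjointFamily {𝕜 : Type u} [RCLike 𝕜] {Ω : Type*} [MeasurableSpace Ω]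
    {m : Measure Ω} {p : ℝ≥0} [Fact (1 ≤ (p : ℝ≥0∞))] {r : Type} [Fintype r]
    (g : r → Lp 𝕜 p m) {ε : ℝ} (hε : 0 < ε) :
    ∃ (ι : Type u) (_ : Fintype ι) (A : DisjointFamily m ι),
      ∀ k, ‖inclLp 𝕜 m p (A.embed 𝕜 (A.means (g k))) - g k‖ ≤ ε := by
  classical
  have hp0 : (p : ℝ≥0∞) ≠ 0 := (zero_lt_one.trans_le (Fact.out : 1 ≤ (p : ℝ≥0∞))).ne'
  have happ : ∀ k, ∃ s : Lp.simpleFunc 𝕜 p m, ‖g k - (s : Lp 𝕜 p m)‖ < ε / 2 := by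
    intro k
    obtain ⟨s, hs⟩ := (Lp.simpleFunc.denseRange (E := 𝕜) (μ := m) (p := p)
      ENNReal.coe_ne_top).exists_dist_lt (g k) (half_pos hε)
    exact ⟨s, by rwa [dist_eq_norm] at hs⟩
  choose s hs using happ
  set σ : r → SimpleFunc Ω 𝕜 := fun k => Lp.simpleFunc.toSimpleFunc (s k) with hσ
  let B : (∀ k, (σ k).range) → Set Ω := fun y => ⋂ k, σ k ⁻¹' {(y k : 𝕜)}
  have hB : ∀ y, MeasurableSet (B y) := fun y =>
    MeasurableSet.iInter fun k => (σ k).measurableSet_preimage _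
  -- The cells are the joint level sets of all the approximating simple functions. Those of infinite
  -- measure may be dropped: a simple function in `L^p` vanishes there.
  let A : DisjointFamily m {y : (∀ k, (σ k).range) // m (B y) ≠ ∞} :=
    { set := fun y => B y.1
      measurableSet := fun y => hB y.1
      measure_ne_top := fun y => y.2
      disjoint := fun y z hyz => by
        rw [disjoint_left]
        intro x hx hx'
        refine hyz (Subtype.ext (funext fun k => Subtype.ext ?_))
        have h1 : σ k x = y.1 k := mem_iInter.1 hx k
        have h2 : σ k x = z.1 k := mem_iInter.1 hx' k
        exact h1.symm.trans h2 }
  refine ⟨_, inferInstance, A, fun k => ?_⟩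
  have hstep : ⇑(s k : Lp 𝕜 p m) =ᵐ[m] A.stepFun fun y => (y.1 k : 𝕜) := by
    refine (Lp.simpleFunc.toSimpleFunc_eq_toFun (s k)).symm.trans
      (Eventually.of_forall fun x => ?_)
    change σ k x = _
    let y : ∀ k, (σ k).range := fun k => ⟨σ k x, (σ k).mem_range_self x⟩
    have hxy : x ∈ B y := mem_iInter.2 fun k => rfl
    by_cases hy : m (B y) = ∞
    · have hout : ∀ z, x ∉ A.set z := by
        intro z hz
        have : z.1 = y := funext fun k => Subtype.ext
          (show (z.1 k : 𝕜) = σ k x from (mem_iInter.1 hz k : σ k x = z.1 k).symm)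
        exact z.2 (this ▸ hy)
      rw [A.stepFun_of_notMem _ hout]
      by_contra hne
      have := (σ k).measure_preimage_lt_top_of_memLp hp0 ENNReal.coe_ne_top
        (Lp.simpleFunc.memLp (s k)) _ hne
      exact this.ne (top_le_iff.1 (hy ▸ measure_mono (iInter_subset _ k)))
    · rw [A.stepFun_of_mem (i := ⟨y, hy⟩) _ hxy]
  exact (A.norm_inclLp_embed_means_sub_le hstep).trans (by linarith [hs k])

/-! ### The maximal inequality for the powers of a single operator -/

section Compression

open Matrix

variable {𝕜 : Type*} [RCLike 𝕜] {Ω : Type*} [MeasurableSpace Ω] {m : Measure Ω}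
variable {ι : Type*} [Fintype ι]

omit [Fintype ι] in
lemma DisjointFamily.norm_means_le_one (A : DisjointFamily m ι) {f : Ω → 𝕜}
    (hf : eLpNorm f ∞ m ≤ 1) (i : ι) : ‖A.means f i‖ ≤ 1 := by
  have h1 : ∀ᵐ x ∂m.restrict (A.set i), ‖f x‖ ≤ 1 := by
    refine ae_restrict_of_ae ?_
    filter_upwards [ae_le_eLpNormEssSup (f := f) (μ := m)] with x hx
    rw [← eLpNorm_exponent_top] at hx
    have := hx.trans hf
    rwa [← ofReal_norm, ENNReal.ofReal_le_one] at this
  have h2 := norm_setIntegral_le_of_norm_le_const_ae (A.measure_ne_top i).lt_top h1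
  rw [DisjointFamily.means, norm_smul, norm_inv, Real.norm_of_nonneg measureReal_nonneg]
  calc _ ≤ (m.real (A.set i))⁻¹ * (1 * m.real (A.set i)) := by gcongr
    _ ≤ 1 := by rw [one_mul]; exact inv_mul_le_one

lemma DisjointFamily.sum_mul_norm_means_le (A : DisjointFamily m ι) (f : Lp 𝕜 1 m) :
    ∑ i, m.real (A.set i) * ‖A.means f i‖ ≤ ‖f‖ := by
  have hf : Integrable f m := L1.integrable_coeFn f
  calc ∑ i, m.real (A.set i) * ‖A.means f i‖ ≤ ∑ i, ∫ x in A.set i, ‖f x‖ ∂m := by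
        refine Finset.sum_le_sum fun i _ => ?_
        rw [DisjointFamily.means, norm_smul, norm_inv, Real.norm_of_nonneg measureReal_nonneg,
          ← mul_assoc]
        calc _ ≤ 1 * ‖∫ x in A.set i, f x ∂m‖ := by gcongr; exact mul_inv_le_one
          _ ≤ _ := by rw [one_mul]; exact norm_integral_le_integral_norm _
    _ = ∫ x in ⋃ i, A.set i, ‖f x‖ ∂m := by
        rw [integral_iUnion_fintype A.measurableSet (fun i j hij => A.disjoint i j hij)
          fun i => hf.norm.integrableOn]
    _ ≤ ∫ x, ‖f x‖ ∂m := setIntegral_le_integral hf.norm (Eventually.of_forall fun _ => norm_nonneg _)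
    _ = ‖f‖ := (L1.norm_eq_integral_norm f).symm

lemma DisjointFamily.eLpNorm_embed_top_le (A : DisjointFamily m ι) {c : ι → 𝕜}
    (hc : ∀ i, ‖c i‖ ≤ 1) : eLpNorm (A.embed 𝕜 c).1 ∞ m ≤ 1 := by
  rw [eLpNorm_congr_ae (A.coeFn_embed c), eLpNorm_exponent_top, ← ENNReal.ofReal_one]
  refine eLpNormEssSup_le_of_ae_bound (Eventually.of_forall fun x => ?_)
  by_cases hx : ∃ i, x ∈ A.set i
  · obtain ⟨i, hi⟩ := hx
    rw [A.stepFun_of_mem _ hi]; exact hc i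
  · push Not at hx
    rw [A.stepFun_of_notMem _ hx, norm_zero]; exact zero_le_one

lemma DisjointFamily.norm_embed (A : DisjointFamily m ι) (c : ι → 𝕜) :
    ‖(A.embed 𝕜 c).1‖ = ∑ i, m.real (A.set i) * ‖c i‖ := by
  rw [Lp.norm_def, eLpNorm_congr_ae (A.coeFn_embed c), eLpNorm_one_eq_lintegral_enorm]
  have h1 : ∀ x, ‖A.stepFun c x‖ₑ = A.stepFun (fun i => ‖c i‖ₑ) x :=
    A.map_stepFun (fun y : 𝕜 => ‖y‖ₑ) (by simp) c
  simp only [h1]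
  rw [A.lintegral_stepFun, ENNReal.toReal_sum fun i _ =>
    ENNReal.mul_ne_top (A.measure_ne_top i) enorm_ne_top]
  simp [Measure.real]

namespace ContractionSemigroup

variable (S : ContractionSemigroup 𝕜 m) (p : ℝ≥0) [Fact (1 ≤ (p : ℝ≥0∞))] (t : ℝ≥0)
  (A : DisjointFamily m ι)

/-- The compression of `T_t` to the functions which are constant on the sets of `A`. -/
noncomputable def compress : Module.End 𝕜 (ι → 𝕜) :=
  A.meansLp 𝕜 p ∘ₗ (S.onLp p t).toLinearMap ∘ₗ inclLp 𝕜 m p ∘ₗ A.embed 𝕜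

lemma compress_apply (c : ι → 𝕜) :
    S.compress p t A c = A.means (S.onLp p t (inclLp 𝕜 m p (A.embed 𝕜 c))) := rfl

/-- Step functions lie in `L¹ ∩ L^∞`, so the compression may be computed with the original `T_t`,
and both contraction properties become available. -/
lemma compress_eq_means (c : ι → 𝕜) :
    S.compress p t A c = A.means (S.T t (A.embed 𝕜 c).1) := by
  rw [compress_apply, onLp_inclLp]
  exact A.means_congr_ae (coeFn_inclLp p _)

variable [DecidableEq ι]

/-- The absolute values of the entries of the matrix of `compress`. -/
noncomputable def compressMatrix : Matrix ι ι ℝ := fun i j =>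
  ‖S.compress p t A (fun k => if j = k then 1 else 0) i‖

lemma compress_apply_eq_sum (c : ι → 𝕜) (i : ι) : S.compress p t A c i =
    ∑ j, c j * S.compress p t A (fun k => if j = k then 1 else 0) i := by
  conv_lhs => rw [LinearMap.pi_apply_eq_sum_univ (S.compress p t A) c]
  simp [Finset.sum_apply]

lemma norm_compress_apply_le (c : ι → 𝕜) (i : ι) : ‖S.compress p t A c i‖ ≤
    ∑ j, S.compressMatrix p t A i j * ‖c j‖ := by
  rw [compress_apply_eq_sum]
  refine (norm_sum_le _ _).trans (Finset.sum_le_sum fun j _ => ?_)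
  rw [norm_mul, mul_comm]; rfl

/-- Passing to absolute values keeps both contraction properties of a matrix: the row sums are the
`ℓ^∞` norm, seen by testing on suitable signs, and the columns are the images of the unit vectors in
the weighted `ℓ¹`. -/
lemma isSubstochastic_compressMatrix :
    IsSubstochastic (fun i => m.real (A.set i)) (S.compressMatrix p t A) where
  weight_nonneg _ := measureReal_nonneg
  nonneg _ _ := norm_nonneg _
  row i := by
    set a : ι → 𝕜 := fun j => S.compress p t A (fun k => if j = k then 1 else 0) i with ha
    -- The conjugate phases of row `i`, equal to `0` where the entry vanishes.
    set c : ι → 𝕜 := fun j => (‖a j‖ : 𝕜)⁻¹ * (starRingEnd 𝕜) (a j) with hc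
    have hc1 : ∀ j, ‖c j‖ ≤ 1 := by
      intro j
      rw [hc]
      simp only [norm_mul, norm_inv, RCLike.norm_ofReal, abs_norm, RCLike.norm_conj]
      exact inv_mul_le_one
    have hca : ∀ j, c j * a j = (‖a j‖ : 𝕜) := by
      intro j
      rw [hc]
      simp only
      rw [mul_assoc, RCLike.conj_mul]
      rcases eq_or_ne (a j) 0 with h | h
      · simp [h]
      · have : (‖a j‖ : 𝕜) ≠ 0 := by simpa using h
        field_simp
    have h1 : S.compress p t A c i = ((∑ j, ‖a j‖ : ℝ) : 𝕜) := by
      rw [compress_apply_eq_sum, RCLike.ofReal_sum]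
      exact Finset.sum_congr rfl fun j _ => hca j
    have h2 : ‖S.compress p t A c i‖ ≤ 1 := by
      rw [compress_eq_means]
      exact A.norm_means_le_one ((S.contraction_top t _).trans (A.eLpNorm_embed_top_le hc1)) i
    rw [h1, RCLike.norm_ofReal, abs_of_nonneg (Finset.sum_nonneg fun _ _ => norm_nonneg _)] at h2
    exact h2
  col j := by
    set e : ι → 𝕜 := fun k => if j = k then 1 else 0 with he
    calc ∑ i, m.real (A.set i) * S.compressMatrix p t A i j
        = ∑ i, m.real (A.set i) * ‖A.means (S.T t (A.embed 𝕜 e).1) i‖ := by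
          refine Finset.sum_congr rfl fun i _ => ?_
          rw [← compress_eq_means S p]; rfl
      _ ≤ ‖S.T t (A.embed 𝕜 e).1‖ := A.sum_mul_norm_means_le _
      _ ≤ ‖(A.embed 𝕜 e).1‖ := by
          rw [Lp.norm_def, Lp.norm_def]
          exact ENNReal.toReal_mono (Lp.eLpNorm_ne_top _) (S.contraction_one t _)
      _ = m.real (A.set j) := by
          rw [A.norm_embed, Finset.sum_eq_single j]
          · simp [he]
          · intro k _ hk; simp [he, hk.symm]
          · simp

lemma norm_compress_pow_apply_le (k : ℕ) (c : ι → 𝕜) (i : ι) :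
    ‖(S.compress p t A ^ k) c i‖ ≤ ((S.compressMatrix p t A ^ k) *ᵥ fun j => ‖c j‖) i := by
  induction k generalizing i with
  | zero => simp
  | succ k ih =>
    rw [pow_succ', Module.End.mul_apply, pow_succ', ← Matrix.mulVec_mulVec]
    refine (S.norm_compress_apply_le p t A _ i).trans ?_
    exact Finset.sum_le_sum fun j _ => mul_le_mul_of_nonneg_left (ih j) (norm_nonneg _)

/-- The discrete averages of `compress` are dominated by the maximal function of its matrix. -/
lemma norm_compress_average_le {K k : ℕ} (hk : k < K + 1) (c : ι → 𝕜) (i : ι) :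
    ‖(((k : ℝ) + 1)⁻¹ • ∑ j ∈ Finset.range (k + 1), (S.compress p t A ^ j) c) i‖ ≤
      matrixMax (S.compressMatrix p t A) K (fun j => ‖c j‖) i := by
  refine le_trans ?_ (Finset.le_sup' (fun n : ℕ => ((n : ℝ) + 1)⁻¹ *
    (powerSum (S.compressMatrix p t A) (n + 1) *ᵥ fun j => ‖c j‖) i) (Finset.mem_range.2 hk))
  rw [Pi.smul_apply, norm_smul, Real.norm_of_nonneg (by positivity), Finset.sum_apply]
  gcongr
  refine (norm_sum_le _ _).trans ?_
  rw [powerSum, Matrix.sum_mulVec, Finset.sum_apply]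
  exact Finset.sum_le_sum fun j _ => S.norm_compress_pow_apply_le p t A j c i

variable {p}

omit [DecidableEq ι] in
-- With `P` the averaging operator, `P T x - T y = P T (x - y) + (P T y - T y)`. Each power
-- therefore multiplies the old error by at most `opBound p` and adds at most `ε`.
lemma norm_inclLp_embed_compress_pow_sub_le (hp : 1 < p) {f : Lp 𝕜 p m} {ε : ℝ} {k : ℕ}
    (hf : ∀ j ≤ k, ‖inclLp 𝕜 m p (A.embed 𝕜 (A.means ((S.onLp p t ^ j) f : Lp 𝕜 p m))) -
      (S.onLp p t ^ j) f‖ ≤ ε) :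
    ‖inclLp 𝕜 m p (A.embed 𝕜 ((S.compress p t A ^ k) (A.means f))) - (S.onLp p t ^ k) f‖ ≤
      (∑ i ∈ Finset.range (k + 1), opBound p ^ i) * ε := by
  induction k with
  | zero => simpa using hf 0 le_rfl
  | succ k ih =>
    have ih := ih fun j hj => hf j (by omega)
    set x := inclLp 𝕜 m p (A.embed 𝕜 ((S.compress p t A ^ k) (A.means f))) with hx
    set y := (S.onLp p t ^ k) f with hy
    have hy' : (S.onLp p t ^ (k + 1)) f = S.onLp p t y := by
      rw [pow_succ']; rfl
    have hx' : (S.compress p t A ^ (k + 1)) (A.means f) = A.means (S.onLp p t x) := by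
      rw [pow_succ', Module.End.mul_apply, compress_apply]
    have hk := hf (k + 1) le_rfl
    rw [hy'] at hk ⊢
    rw [hx']
    have hsplit : inclLp 𝕜 m p (A.embed 𝕜 (A.means (S.onLp p t x))) - S.onLp p t y =
        inclLp 𝕜 m p (A.embed 𝕜 (A.means (S.onLp p t (x - y)))) +
          (inclLp 𝕜 m p (A.embed 𝕜 (A.means (S.onLp p t y))) - S.onLp p t y) := by
      simp only [← DisjointFamily.meansLp_apply, map_sub]
      abel
    rw [hsplit, geom_sum_succ, add_mul, one_mul]
    refine (norm_add_le _ _).trans (add_le_add ?_ hk)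
    refine (A.norm_inclLp_embed_means_le _).trans ((S.norm_onLp_le hp t _).trans ?_)
    rw [mul_assoc]
    exact mul_le_mul_of_nonneg_left ih (opBound_nonneg hp)

end ContractionSemigroup

lemma DisjointFamily.mixedNorm_stepFun (A : DisjointFamily m ι) {p q : ℝ} (hp : 0 < p)
    (hq : 0 < q) (s : Finset ℕ) {v : ℕ → ι → ℝ} (hv : ∀ n i, 0 ≤ v n i) :
    mixedNorm p q m s (fun n x => A.stepFun (fun i => ENNReal.ofReal (v n i)) x) =
      ENNReal.ofReal (∑ i, m.real (A.set i) * (∑ n ∈ s, v n i ^ q) ^ (p / q)) ^ (1 / p) := by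
  have hS : ∀ i, 0 ≤ ∑ n ∈ s, v n i ^ q := fun i =>
    Finset.sum_nonneg fun n _ => Real.rpow_nonneg (hv n i) _
  have h1 : ∀ x, ((∑ n ∈ s, A.stepFun (fun i => ENNReal.ofReal (v n i)) x ^ q) ^ (1 / q)) ^ p =
      A.stepFun (fun i => ENNReal.ofReal ((∑ n ∈ s, v n i ^ q) ^ (p / q))) x := by
    intro x
    by_cases hx : ∃ i, x ∈ A.set i
    · obtain ⟨i, hi⟩ := hx
      simp only [A.stepFun_of_mem _ hi]
      rw [← ENNReal.rpow_mul, one_div_mul_eq_div, ← ENNReal.ofReal_rpow_of_nonneg (hS i)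
        (by positivity), ENNReal.ofReal_sum_of_nonneg fun n _ => Real.rpow_nonneg (hv n i) _]
      simp only [ENNReal.ofReal_rpow_of_nonneg (hv _ i) hq.le]
    · push Not at hx
      simp [A.stepFun_of_notMem _ hx, hp, hq]
  unfold mixedNorm
  simp only [h1]
  rw [A.lintegral_stepFun, ENNReal.ofReal_sum_of_nonneg fun i _ =>
    mul_nonneg measureReal_nonneg (Real.rpow_nonneg (hS i) _)]
  congr 1
  refine Finset.sum_congr rfl fun i _ => ?_
  rw [ENNReal.ofReal_mul measureReal_nonneg, ofReal_measureReal (A.measure_ne_top i)]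

end Compression

/-! ### From the compressions to the operator itself -/

section Discrete

variable {𝕜 : Type*} [RCLike 𝕜] {Ω : Type*} [MeasurableSpace Ω] {m : Measure Ω}
  {p : ℝ≥0} [Fact (1 ≤ (p : ℝ≥0∞))]

lemma lintegral_enorm_rpow_eq_norm (f : Lp 𝕜 p m) :
    (∫⁻ x, ‖f x‖ₑ ^ (p : ℝ) ∂m) ^ (1 / (p : ℝ)) = ENNReal.ofReal ‖f‖ := by
  have hp0 : (p : ℝ≥0∞) ≠ 0 := (zero_lt_one.trans_le (Fact.out : 1 ≤ (p : ℝ≥0∞))).ne'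
  rw [Lp.norm_def, ENNReal.ofReal_toReal (Lp.eLpNorm_ne_top f),
    eLpNorm_eq_lintegral_rpow_enorm_toReal hp0 ENNReal.coe_ne_top, ENNReal.coe_toReal]

lemma mixedNorm_enorm_le_add {q : ℝ} (hq : 1 ≤ q) (s : Finset ℕ) (f g : ℕ → Lp 𝕜 p m) :
    mixedNorm p q m s (fun n x => ‖f n x‖ₑ) ≤ mixedNorm p q m s (fun n x => ‖g n x‖ₑ) +
      ∑ n ∈ s, ENNReal.ofReal ‖f n - g n‖ := by
  have hp1 : (1 : ℝ) ≤ p := by exact_mod_cast (Fact.out : 1 ≤ (p : ℝ≥0∞))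
  simp only [← lintegral_enorm_rpow_eq_norm]
  refine mixedNorm_le_add_sum hp1 hq (fun n _ => (Lp.aestronglyMeasurable _).enorm)
    (fun n _ => (Lp.aestronglyMeasurable _).enorm) fun n _ => ?_
  filter_upwards [Lp.coeFn_sub (f n) (g n)] with x hx
  rw [hx, Pi.sub_apply]
  calc ‖f n x‖ₑ = ‖g n x + (f n x - g n x)‖ₑ := by rw [add_sub_cancel]
    _ ≤ _ := enorm_add_le _ _

omit [Fact (1 ≤ (p : ℝ≥0∞))] in
lemma aemeasurable_finset_sup_enorm (K : ℕ) (f : ℕ → Lp 𝕜 p m) :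
    AEMeasurable (fun x => (Finset.range K).sup fun k => ‖f k x‖ₑ) m := by
  simp only [Finset.sup_eq_iSup]
  exact AEMeasurable.biSup _ (Finset.range K).countable_toSet
    fun k _ => (Lp.aestronglyMeasurable _).enorm

/-- Stability of the `L^p(ℓ^q)` norm of maximal functions. -/
lemma mixedNorm_sup_enorm_le_add {q : ℝ} (hq : 1 ≤ q) (s : Finset ℕ) (K : ℕ)
    (f g : ℕ → ℕ → Lp 𝕜 p m) :
    mixedNorm p q m s (fun n x => (Finset.range K).sup fun k => ‖f n k x‖ₑ) ≤
      mixedNorm p q m s (fun n x => (Finset.range K).sup fun k => ‖g n k x‖ₑ) +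
        ∑ n ∈ s, ∑ k ∈ Finset.range K, ENNReal.ofReal ‖f n k - g n k‖ := by
  have hp1 : (1 : ℝ) ≤ p := by exact_mod_cast (Fact.out : 1 ≤ (p : ℝ≥0∞))
  have hm : ∀ n, AEMeasurable (fun x => ∑ k ∈ Finset.range K, ‖(f n k - g n k) x‖ₑ) m := fun n =>
    Finset.aemeasurable_fun_sum _ fun k _ => (Lp.aestronglyMeasurable _).enorm
  refine (mixedNorm_le_add_sum hp1 hq (fun n _ => aemeasurable_finset_sup_enorm K (g n))
    (d := fun n x => ∑ k ∈ Finset.range K, ‖(f n k - g n k) x‖ₑ) (fun n _ => hm n)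
    fun n _ => ?_).trans (add_le_add_right (Finset.sum_le_sum fun n _ => ?_) _)
  · have hae : ∀ᵐ x ∂m, ∀ k, (f n k - g n k : Lp 𝕜 p m) x = f n k x - g n k x :=
      ae_all_iff.2 fun k => Lp.coeFn_sub _ _
    filter_upwards [hae] with x hx
    refine Finset.sup_le fun k hk => ?_
    calc ‖f n k x‖ₑ = ‖g n k x + (f n k - g n k) x‖ₑ := by rw [hx, add_sub_cancel]
      _ ≤ ‖g n k x‖ₑ + ‖(f n k - g n k) x‖ₑ := enorm_add_le _ _
      _ ≤ _ := add_le_add (Finset.le_sup (f := fun k => ‖g n k x‖ₑ) hk)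
          (Finset.single_le_sum (f := fun k => ‖(f n k - g n k) x‖ₑ) (fun _ _ => zero_le) hk)
  · simp only [← lintegral_enorm_rpow_eq_norm]
    -- For `q = 1` the mixed norm is the `L^p` norm of the pointwise sum, so this is Minkowski's
    -- inequality over `k`.
    have := mixedNorm_le_sum (p := p) (q := 1) (m := m) (s := Finset.range K) hp1 le_rfl
      (g := fun k x => ‖(f n k - g n k) x‖ₑ) fun k _ => (Lp.aestronglyMeasurable _).enorm
    simpa [mixedNorm] using this

namespace ContractionSemigroup

variable (S : ContractionSemigroup 𝕜 m)

/-- The discrete averages `(1/(k+1)) ∑_{j ≤ k} T_t^j f`. -/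
noncomputable def discreteAverage (t : ℝ≥0) (k : ℕ) (f : Lp 𝕜 p m) : Lp 𝕜 p m :=
  ((k : ℝ) + 1)⁻¹ • ∑ j ∈ Finset.range (k + 1), (S.onLp p t ^ j) f

lemma mixedNorm_sup_compress_average_le {ι : Type*} [Fintype ι] (A : DisjointFamily m ι)
    (hp : 1 < p) {q : ℝ} (hpq : p ≤ q) (t : ℝ≥0) (s : Finset ℕ) (c : ℕ → ι → 𝕜) (K : ℕ) :
    mixedNorm p q m s (fun n x => (Finset.range (K + 1)).sup fun k =>
        ‖inclLp 𝕜 m p (A.embed 𝕜 (((k : ℝ) + 1)⁻¹ •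
          ∑ j ∈ Finset.range (k + 1), (S.compress p t A ^ j) (c n))) x‖ₑ) ≤
      ENNReal.ofReal (p / (p - 1)) *
        mixedNorm p q m s (fun n x => ‖inclLp 𝕜 m p (A.embed 𝕜 (c n)) x‖ₑ) := by
  classical
  have hp1 : (1 : ℝ) < p := by exact_mod_cast hp
  have hpp : 0 < (p : ℝ) := by linarith
  have hq0 : 0 < q := by linarith
  have hb := S.isSubstochastic_compressMatrix p t A
  set b := S.compressMatrix p t A
  have hM : ∀ n i, 0 ≤ matrixMax b K (fun j => ‖c n j‖) i := fun n =>
    matrixMax_nonneg hb K fun i => norm_nonneg _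
  have hC : 0 ≤ (p : ℝ) / (p - 1) := div_nonneg hpp.le (by linarith)
  have hleft : mixedNorm p q m s (fun n x => (Finset.range (K + 1)).sup fun k =>
      ‖inclLp 𝕜 m p (A.embed 𝕜 (((k : ℝ) + 1)⁻¹ •
        ∑ j ∈ Finset.range (k + 1), (S.compress p t A ^ j) (c n))) x‖ₑ) ≤
      mixedNorm p q m s (fun n x =>
        A.stepFun (fun i => ENNReal.ofReal (matrixMax b K (fun j => ‖c n j‖) i)) x) := by
    refine mixedNorm_mono_ae hpp hq0 fun n _ => ?_
    filter_upwards [ae_all_iff.2 fun k : ℕ => A.coeFn_inclLp_embed (p := p) (((k : ℝ) + 1)⁻¹ •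
        ∑ j ∈ Finset.range (k + 1), (S.compress p t A ^ j) (c n))] with x hx
    refine Finset.sup_le fun k hk => ?_
    rw [hx k]
    by_cases hxe : ∃ i, x ∈ A.set i
    · obtain ⟨i, hi⟩ := hxe
      rw [A.stepFun_of_mem _ hi, A.stepFun_of_mem _ hi, ← ofReal_norm]
      exact ENNReal.ofReal_le_ofReal
        (S.norm_compress_average_le p t A (Finset.mem_range.1 hk) (c n) i)
    · push Not at hxe
      rw [A.stepFun_of_notMem _ hxe, enorm_zero]; exact zero_le
  have hright : mixedNorm p q m s (fun n x => ‖inclLp 𝕜 m p (A.embed 𝕜 (c n)) x‖ₑ) =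
      mixedNorm p q m s (fun n x => A.stepFun (fun i => ENNReal.ofReal ‖c n i‖) x) := by
    refine mixedNorm_congr_ae fun n _ => ?_
    filter_upwards [A.coeFn_inclLp_embed (p := p) (c n)] with x hx
    rw [hx]
    simp only [ofReal_norm]
    exact A.map_stepFun (fun y : 𝕜 => ‖y‖ₑ) (by simp) (c n) x
  refine hleft.trans ?_
  rw [hright, A.mixedNorm_stepFun hpp hq0 s hM,
    A.mixedNorm_stepFun hpp hq0 s fun n i => norm_nonneg (c n i)]
  have := hb.sum_matrixMax_lpLq_le K s (u := fun n i => ‖c n i‖) (fun n i => norm_nonneg _)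
    hp1 hpq
  refine (ENNReal.rpow_le_rpow (ENNReal.ofReal_le_ofReal this) (by positivity)).trans
    (le_of_eq ?_)
  rw [ENNReal.ofReal_mul (by positivity), ENNReal.mul_rpow_of_nonneg _ _ (by positivity),
    ← ENNReal.ofReal_rpow_of_nonneg hC hpp.le, ← ENNReal.rpow_mul, mul_one_div_cancel hpp.ne',
    ENNReal.rpow_one]

/-- The vector-valued maximal inequality for the powers of `T_t`. -/
lemma mixedNorm_sup_discreteAverage_le (hp : 1 < p) {q : ℝ} (hpq : p ≤ q) (t : ℝ≥0)
    (s : Finset ℕ) (f : ℕ → Lp 𝕜 p m) (K : ℕ) :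
    mixedNorm p q m s (fun n x => (Finset.range (K + 1)).sup fun k =>
        ‖S.discreteAverage t k (f n) x‖ₑ) ≤
      ENNReal.ofReal (p / (p - 1)) * mixedNorm p q m s (fun n x => ‖f n x‖ₑ) := by
  have hp1 : (1 : ℝ) < p := by exact_mod_cast hp
  have hB := opBound_nonneg hp
  set C := ENNReal.ofReal (p / (p - 1)) with hC
  set R := mixedNorm p q m s (fun n x => ‖f n x‖ₑ)
  set G : ℝ := ∑ i ∈ Finset.range (K + 1), opBound p ^ i with hG
  have hG0 : 0 ≤ G := Finset.sum_nonneg fun i _ => pow_nonneg hB i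
  -- One family of sets approximates all orbit points `T_t^j (f n)` with `j ≤ K`, `n ∈ s`. Since `G`
  -- depends on `K` but not on `ε`, the errors vanish as `ε → 0`.
  have key : ∀ ε : ℝ, 0 < ε → mixedNorm p q m s (fun n x => (Finset.range (K + 1)).sup fun k =>
      ‖S.discreteAverage t k (f n) x‖ₑ) ≤ C * (R + ∑ n ∈ s, ENNReal.ofReal ε) +
        ∑ n ∈ s, ∑ k ∈ Finset.range (K + 1), ENNReal.ofReal (G * ε) := by
    intro ε hε
    obtain ⟨ι, _, A, hA⟩ := exists_disjointFamily (r := s × Fin (K + 1))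
      (fun a => (S.onLp p t ^ (a.2 : ℕ)) (f a.1)) hε
    have hA' : ∀ n ∈ s, ∀ j < K + 1,
        ‖inclLp 𝕜 m p (A.embed 𝕜 (A.means ((S.onLp p t ^ j) (f n) : Lp 𝕜 p m))) -
          (S.onLp p t ^ j) (f n)‖ ≤ ε := fun n hn j hj => hA (⟨n, hn⟩, ⟨j, hj⟩)
    have happ : ∀ n ∈ s, ∀ j < K + 1,
        ‖inclLp 𝕜 m p (A.embed 𝕜 ((S.compress p t A ^ j) (A.means (f n)))) -
          (S.onLp p t ^ j) (f n)‖ ≤ G * ε := by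
      intro n hn j hj
      refine (S.norm_inclLp_embed_compress_pow_sub_le t A hp
        fun i hi => hA' n hn i (by omega)).trans ?_
      gcongr
      refine Finset.sum_le_sum_of_subset_of_nonneg (Finset.range_subset_range.2 (by omega))
        fun i _ _ => pow_nonneg hB i
    set V : ℕ → ℕ → Lp 𝕜 p m := fun n k => inclLp 𝕜 m p (A.embed 𝕜 (((k : ℝ) + 1)⁻¹ •
      ∑ j ∈ Finset.range (k + 1), (S.compress p t A ^ j) (A.means (f n)))) with hV
    have hVd : ∀ n ∈ s, ∀ k ∈ Finset.range (K + 1),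
        ‖S.discreteAverage t k (f n) - V n k‖ ≤ G * ε := by
      intro n hn k hk
      have hk := Finset.mem_range.1 hk
      have h1 : V n k = ((k : ℝ) + 1)⁻¹ • ∑ j ∈ Finset.range (k + 1),
          inclLp 𝕜 m p (A.embed 𝕜 ((S.compress p t A ^ j) (A.means (f n)))) := by
        rw [hV]
        simp only
        rw [← map_sum, ← map_sum, LinearMap.map_smul_of_tower, LinearMap.map_smul_of_tower]
      rw [h1, discreteAverage, ← smul_sub, ← Finset.sum_sub_distrib, norm_smul,
        Real.norm_of_nonneg (by positivity)]
      calc _ ≤ ((k : ℝ) + 1)⁻¹ * ∑ j ∈ Finset.range (k + 1), G * ε := by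
            gcongr
            refine (norm_sum_le _ _).trans (Finset.sum_le_sum fun j hj => ?_)
            rw [norm_sub_rev]
            exact happ n hn j (by have := Finset.mem_range.1 hj; omega)
        _ = G * ε := by
            rw [Finset.sum_const, Finset.card_range, nsmul_eq_mul]
            push_cast
            field_simp
    refine (mixedNorm_sup_enorm_le_add (by linarith) s (K + 1)
      (fun n k => S.discreteAverage t k (f n)) V).trans (add_le_add ?_ ?_)
    · refine (S.mixedNorm_sup_compress_average_le A hp hpq t s (fun n => A.means (f n)) K).trans ?_
      gcongr
      refine (mixedNorm_enorm_le_add (by linarith) s _ f).trans ?_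
      gcongr with n hn
      simpa using hA' n hn 0 (by omega)
    · refine Finset.sum_le_sum fun n hn => Finset.sum_le_sum fun k hk => ?_
      exact ENNReal.ofReal_le_ofReal (hVd n hn k hk)
  have hε : Tendsto (fun j : ℕ => 1 / ((j : ℝ) + 1)) atTop (𝓝 0) :=
    tendsto_one_div_add_atTop_nhds_zero_nat
  have hlim : Tendsto (fun j : ℕ => C * (R + ∑ n ∈ s, ENNReal.ofReal (1 / ((j : ℝ) + 1))) +
      ∑ n ∈ s, ∑ k ∈ Finset.range (K + 1), ENNReal.ofReal (G * (1 / ((j : ℝ) + 1)))) atTop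
      (𝓝 (C * (R + ∑ n ∈ s, ENNReal.ofReal 0) +
        ∑ n ∈ s, ∑ k ∈ Finset.range (K + 1), ENNReal.ofReal (G * 0))) := by
    refine Tendsto.add (ENNReal.Tendsto.const_mul (tendsto_const_nhds.add
      (tendsto_finsetSum _ fun n _ => (ENNReal.continuous_ofReal.tendsto _).comp hε))
      (Or.inr ENNReal.ofReal_ne_top)) ?_
    exact tendsto_finsetSum _ fun n _ => tendsto_finsetSum _ fun k _ =>
      (ENNReal.continuous_ofReal.tendsto _).comp (hε.const_mul G)
  have := ge_of_tendsto' hlim fun j => key (1 / ((j : ℝ) + 1)) (by positivity)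
  simpa using this

end ContractionSemigroup

end Discrete

/-! ### The maximal function -/

section DyadicSup

/-- The supremum of `g` over the points `(k + 1) 2⁻ʲ`, `k ≤ 4ʲ`. -/
noncomputable def dyadicSup (j : ℕ) (g : ℝ≥0 → ℝ≥0∞) : ℝ≥0∞ :=
  (Finset.range (4 ^ j + 1)).sup fun k => g (((k + 1 : ℕ) : ℝ≥0) * (1 / 2) ^ j)

lemma monotone_dyadicSup (g : ℝ≥0 → ℝ≥0∞) : Monotone fun j => dyadicSup j g := by
  refine monotone_nat_of_le_succ fun j => Finset.sup_le fun k hk => ?_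
  have hk := Finset.mem_range.1 hk
  have h1 : 1 ≤ 4 ^ j := Nat.one_le_pow _ _ (by norm_num)
  -- Indices are shifted by one: `(k + 1) 2⁻ʲ = ((2 k + 1) + 1) 2⁻⁽ʲ⁺¹⁾`.
  have h2 : 2 * k + 1 ∈ Finset.range (4 ^ (j + 1) + 1) :=
    Finset.mem_range.2 (by rw [pow_succ]; omega)
  refine le_trans (le_of_eq ?_)
    (Finset.le_sup (f := fun k : ℕ => g (((k + 1 : ℕ) : ℝ≥0) * (1 / 2) ^ (j + 1))) h2)
  congr 1
  push_cast
  rw [pow_succ]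
  field_simp
  ring

/-- The supremum of a function which is continuous on `(0, ∞)` is determined by its values at `0`
and at the positive dyadic numbers. -/
lemma iSup_eq_sup_iSup_dyadicSup {g : ℝ≥0 → ℝ≥0∞} (hg : ContinuousOn g (Ioi 0)) :
    ⨆ α, g α = g 0 ⊔ ⨆ j, dyadicSup j g := by
  refine le_antisymm (iSup_le fun α => ?_)
    (sup_le (le_iSup g 0) (iSup_le fun j => Finset.sup_le fun k _ => le_iSup g _))
  rcases eq_or_ne α 0 with rfl | hα
  · exact le_sup_left
  have hα : 0 < α := pos_iff_ne_zero.2 hα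
  refine le_sup_of_le_right ?_
  -- Rounding up keeps the grid points positive. Their index `⌊α 2ʲ⌋` is at most `4ʲ` as soon as `α
  -- ≤ 2ʲ`.
  have hgrid : ∀ j : ℕ, dyadicFloor j α + (1 / 2) ^ j =
      ((⌊α * 2 ^ j⌋₊ + 1 : ℕ) : ℝ≥0) * (1 / 2) ^ j := by
    intro j
    rw [dyadicFloor, div_eq_mul_inv, one_div, inv_pow]
    push_cast; ring
  have hlim : Tendsto (fun j : ℕ => dyadicFloor j α + (1 / 2 : ℝ≥0) ^ j) atTop (𝓝 α) := by
    have h1 : (1 / 2 : ℝ≥0) < 1 := by rw [← NNReal.coe_lt_coe]; push_cast; norm_num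
    simpa using (tendsto_dyadicFloor α).add (NNReal.tendsto_pow_atTop_nhds_zero_of_lt_one h1)
  have hgα : Tendsto g (𝓝 α) (𝓝 (g α)) := (hg.continuousAt (Ioi_mem_nhds hα)).tendsto
  refine le_of_tendsto (hgα.comp hlim) ?_
  obtain ⟨N, hN⟩ := exists_nat_gt α
  filter_upwards [eventually_ge_atTop N] with j hj
  refine le_iSup_of_le j ?_
  rw [Function.comp_apply, hgrid]
  refine Finset.le_sup (f := fun k : ℕ => g (((k + 1 : ℕ) : ℝ≥0) * (1 / 2) ^ j))
    (Finset.mem_range.2 (Nat.lt_succ_of_le (Nat.floor_le_of_le ?_)))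
  have h1 : (N : ℝ≥0) ≤ 2 ^ j := by
    exact_mod_cast hj.trans Nat.lt_two_pow_self.le
  have h2 : ((4 ^ j : ℕ) : ℝ≥0) = 2 ^ j * 2 ^ j := by
    push_cast; rw [← mul_pow]; norm_num
  rw [h2]
  gcongr
  exact hN.le.trans h1

end DyadicSup

/-! ### Continuous versions and the maximal inequality for the averages -/

namespace ContractionSemigroup

variable {𝕜 : Type*} [RCLike 𝕜] {Ω : Type*} [MeasurableSpace Ω] {m : Measure Ω}
  (S : ContractionSemigroup 𝕜 m) {p : ℝ≥0} [Fact (1 ≤ (p : ℝ≥0∞))]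

lemma lipschitzWith_integral_onLp (hp : 1 < p) (f : Lp 𝕜 p m) :
    LipschitzWith (opBound p * ‖f‖).toNNReal
      fun α : ℝ≥0 => ∫ t in (0 : ℝ)..α, S.onLp p t.toNNReal f := by
  refine LipschitzWith.of_dist_le_mul fun α β => ?_
  rw [dist_eq_norm, intervalIntegral.integral_interval_sub_left
    (S.intervalIntegrable_onLp hp f _ _) (S.intervalIntegrable_onLp hp f _ _),
    Real.coe_toNNReal _ (mul_nonneg (opBound_nonneg hp) (norm_nonneg _)), NNReal.dist_eq]
  exact intervalIntegral.norm_integral_le_of_norm_le_const fun t _ => S.norm_onLp_le hp _ f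

lemma exists_isAverageVersion (hp : 1 < p) (f : Lp 𝕜 p m) :
    ∃ u : ℝ≥0 → Ω → 𝕜, S.IsAverageVersion p f u := by
  obtain ⟨v, hv, hvc⟩ := exists_continuous_version hp (S.lipschitzWith_integral_onLp hp f)
  refine ⟨fun α x => if α = 0 then f x else (α : ℝ)⁻¹ • v α x, fun α => ?_, ?_⟩
  · rcases eq_or_ne α 0 with rfl | hα
    · simp only [if_true, average_zero]; exact EventuallyEq.rfl
    · simp only [if_neg hα, S.average_of_pos f (pos_iff_ne_zero.2 hα)]
      filter_upwards [hv α, Lp.coeFn_smul (α : ℝ)⁻¹ (∫ t in (0 : ℝ)..α, S.onLp p t.toNNReal f)]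
        with x h1 h2
      rw [h1, h2, Pi.smul_apply]
  · filter_upwards [hvc] with x hx
    have h1 : ContinuousOn (fun α : ℝ≥0 => (α : ℝ)⁻¹ • v α x) (Ioi 0) := by
      refine ContinuousOn.smul (ContinuousOn.inv₀ (by fun_prop) fun α hα => ?_) hx.continuousOn
      exact_mod_cast (show (0 : ℝ≥0) < α from hα).ne'
    exact h1.congr fun α hα => if_neg (show (0 : ℝ≥0) < α from hα).ne'

/-- Only countably many times matter, and at these any two versions agree off one null set. This
yields both the measurability of `M` and its independence of the version. -/
lemma IsMaximalFunction.ae_eq {f : Lp 𝕜 p m} {M : Ω → ℝ≥0∞} (hM : S.IsMaximalFunction p f M) :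
    M =ᵐ[m] fun x => ‖f x‖ₑ ⊔ ⨆ j, dyadicSup j fun α => ‖S.average p f α x‖ₑ := by
  obtain ⟨u, ⟨hu, huc⟩, hMu⟩ := hM
  have hd : ∀ᵐ x ∂m, ∀ j k : ℕ, u (((k + 1 : ℕ) : ℝ≥0) * (1 / 2) ^ j) x =
      S.average p f (((k + 1 : ℕ) : ℝ≥0) * (1 / 2) ^ j) x :=
    ae_all_iff.2 fun j => ae_all_iff.2 fun k => hu _
  filter_upwards [hd, hMu, huc, hu 0] with x h1 h2 h3 h4
  rw [average_zero] at h4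
  rw [h2, iSup_eq_sup_iSup_dyadicSup (g := fun α => ‖u α x‖ₑ) h3.enorm, h4]
  simp only [dyadicSup, h1]

lemma aemeasurable_dyadicSup_average (f : Lp 𝕜 p m) (j : ℕ) :
    AEMeasurable (fun x => dyadicSup j fun α => ‖S.average p f α x‖ₑ) m :=
  aemeasurable_finset_sup_enorm (4 ^ j + 1)
    fun k => S.average p f (((k + 1 : ℕ) : ℝ≥0) * (1 / 2) ^ j)

/-- The discrete inequality is applied to `A_δ f` with `δ = 2⁻ⁱ`. The grid of level `i ≥ j` contains
that of level `j`, so `i → ∞` with `j` fixed replaces `A_δ f` by `f`. -/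
lemma mixedNorm_dyadicSup_average_le (hp : 1 < p) {q : ℝ} (hpq : p ≤ q) (s : Finset ℕ)
    (f : ℕ → Lp 𝕜 p m) (j : ℕ) :
    mixedNorm p q m s (fun n x => dyadicSup j fun α => ‖S.average p (f n) α x‖ₑ) ≤
      ENNReal.ofReal (p / (p - 1)) * mixedNorm p q m s (fun n x => ‖f n x‖ₑ) := by
  have hp1 : (1 : ℝ) < p := by exact_mod_cast hp
  set C := ENNReal.ofReal (p / (p - 1))
  set R := mixedNorm p q m s (fun n x => ‖f n x‖ₑ)
  set δ : ℕ → ℝ≥0 := fun j => (1 / 2) ^ j with hδ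
  have hδ0 : ∀ j, 0 < δ j := fun j => by positivity
  have hδl : Tendsto δ atTop (𝓝 0) := by
    have h1 : (1 / 2 : ℝ≥0) < 1 := by rw [← NNReal.coe_lt_coe]; push_cast; norm_num
    exact NNReal.tendsto_pow_atTop_nhds_zero_of_lt_one h1
  have hstep : ∀ i, mixedNorm p q m s
      (fun n x => dyadicSup i fun α => ‖S.average p (f n) α x‖ₑ) ≤
      C * (R + ∑ n ∈ s, ENNReal.ofReal ‖S.average p (f n) (δ i) - f n‖) := by
    intro i
    have h1 := S.mixedNorm_sup_discreteAverage_le hp hpq (δ i) s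
      (fun n => S.average p (f n) (δ i)) (4 ^ i)
    have h2 : ∀ n k, S.discreteAverage (δ i) k (S.average p (f n) (δ i)) =
        S.average p (f n) (((k + 1 : ℕ) : ℝ≥0) * δ i) := by
      intro n k
      rw [S.average_nat_mul hp (f n) (hδ0 i) k.succ_pos, discreteAverage]
      push_cast; rfl
    simp only [h2] at h1
    refine h1.trans ?_
    gcongr
    exact mixedNorm_enorm_le_add (by linarith) s _ f
  have hlim : Tendsto (fun i => C * (R + ∑ n ∈ s,
      ENNReal.ofReal ‖S.average p (f n) (δ i) - f n‖)) atTop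
      (𝓝 (C * (R + ∑ n ∈ s, ENNReal.ofReal 0))) := by
    refine ENNReal.Tendsto.const_mul (tendsto_const_nhds.add (tendsto_finsetSum _ fun n _ =>
      (ENNReal.continuous_ofReal.tendsto _).comp ?_)) (Or.inr ENNReal.ofReal_ne_top)
    exact tendsto_iff_norm_sub_tendsto_zero.1 (S.tendsto_average hp (f n) hδ0 hδl)
  have := ge_of_tendsto hlim (b := mixedNorm p q m s
    (fun n x => dyadicSup j fun α => ‖S.average p (f n) α x‖ₑ)) ?_
  · simpa using this
  · filter_upwards [eventually_ge_atTop j] with i hi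
    refine le_trans (mixedNorm_mono_ae (by linarith) (by linarith) fun n _ =>
      Eventually.of_forall fun x => ?_) (hstep i)
    exact monotone_dyadicSup (fun α => ‖S.average p (f n) α x‖ₑ) hi

lemma mixedNorm_sup_iSup_dyadicSup_average_le (hp : 1 < p) {q : ℝ} (hpq : p ≤ q) (s : Finset ℕ)
    (f : ℕ → Lp 𝕜 p m) :
    mixedNorm p q m s
        (fun n x => ‖f n x‖ₑ ⊔ ⨆ j, dyadicSup j fun α => ‖S.average p (f n) α x‖ₑ) ≤
      (1 + ENNReal.ofReal (p / (p - 1))) * mixedNorm p q m s (fun n x => ‖f n x‖ₑ) := by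
  have hp1 : (1 : ℝ) < p := by exact_mod_cast hp
  have hq1 : 1 ≤ q := by linarith
  have hf : ∀ n, AEMeasurable (fun x => ‖f n x‖ₑ) m := fun n =>
    (Lp.aestronglyMeasurable (f n)).enorm
  refine (mixedNorm_mono_ae (by linarith) (by linarith) fun n _ => Eventually.of_forall fun x =>
    sup_le le_self_add le_add_self).trans ((mixedNorm_add_le hp1.le hq1 (fun n _ => hf n)
      fun n _ => AEMeasurable.iSup fun j => S.aemeasurable_dyadicSup_average (f n) j).trans ?_)
  rw [add_mul, one_mul]
  gcongr
  refine mixedNorm_le_of_tendsto (by linarith)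
    (g := fun j n x => dyadicSup j fun α => ‖S.average p (f n) α x‖ₑ)
    (fun j n _ => S.aemeasurable_dyadicSup_average (f n) j)
    (fun n _ => Eventually.of_forall fun x => tendsto_atTop_iSup (monotone_dyadicSup _))
    fun j => S.mixedNorm_dyadicSup_average_le hp hpq s f j

end ContractionSemigroup

end HopfDunfordSchwartz

/-! ### The maximal theorem in `L^p(ℓ^q)` -/

theorem mainTheorem1 (p q : ℝ≥0) [Fact (1 ≤ (p : ℝ≥0∞))] (hp : 1 < p) (hpq : p ≤ q) :
    ∃ C : ℝ≥0, ∀ (𝕜 : Type*) [RCLike 𝕜] (Ω : Type*) [MeasurableSpace Ω] (m : Measure Ω)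
      (S : HopfDunfordSchwartz.ContractionSemigroup 𝕜 m) (f : ℕ → Ω → 𝕜)
      (hf : HopfDunfordSchwartz.MemLpLq p q m f),
      (∀ (n : ℕ) (α : ℝ≥0), IntervalIntegrable
        (fun t : ℝ => S.onLp p t.toNNReal ((hf.memLp hpq n).toLp (f n))) volume 0 α) ∧
      (∀ n : ℕ, ∃ M : Ω → ℝ≥0∞, S.IsMaximalFunction p ((hf.memLp hpq n).toLp (f n)) M) ∧
      ∀ M : ℕ → Ω → ℝ≥0∞,
        (∀ n : ℕ, S.IsMaximalFunction p ((hf.memLp hpq n).toLp (f n)) (M n)) →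
        (∀ n : ℕ, AEMeasurable (M n) m) ∧
        HopfDunfordSchwartz.lpLqNorm p q m M ≤
          C * HopfDunfordSchwartz.lpLqNorm p q m (fun n x => ‖f n x‖ₑ) := by
  -- The summand `1` accounts for `α = 0`, and `p / (p - 1)` for all `α > 0`.
  refine ⟨1 + (p / (p - 1) : ℝ).toNNReal, fun 𝕜 _ Ω _ m S f hf => ⟨fun n α =>
    S.intervalIntegrable_onLp hp _ _ _, fun n => ?_, fun M hM => ?_⟩⟩
  · obtain ⟨u, hu⟩ := S.exists_isAverageVersion hp ((hf.memLp hpq n).toLp (f n))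
    exact ⟨_, u, hu, Eventually.of_forall fun _ => rfl⟩
  have hMeas : ∀ n, AEMeasurable (M n) m := by
    intro n
    refine AEMeasurable.congr ?_ (hM n).ae_eq.symm
    exact (Lp.aestronglyMeasurable _).enorm.sup
      (AEMeasurable.iSup fun j => S.aemeasurable_dyadicSup_average _ j)
  refine ⟨hMeas, HopfDunfordSchwartz.lpLqNorm_le_of_forall_mixedNorm_le q
    (zero_lt_one.trans hp) hMeas fun N => ?_⟩
  rw [HopfDunfordSchwartz.mixedNorm_congr_ae fun n _ => (hM n).ae_eq]
  refine (S.mixedNorm_sup_iSup_dyadicSup_average_le hp (by exact_mod_cast hpq) _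
    fun n => (hf.memLp hpq n).toLp (f n)).trans ?_
  rw [HopfDunfordSchwartz.mixedNorm_congr_ae (h := fun n x => ‖f n x‖ₑ) fun n _ => by
    filter_upwards [(hf.memLp hpq n).coeFn_toLp] with x hx
    rw [hx], ENNReal.coe_add, ENNReal.coe_one]
  exact mul_le_mul_right (HopfDunfordSchwartz.mixedNorm_le_lpLqNorm p q _ _) _
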